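/- **Setting.** Let $G=(V,E)$ be a finite connected undirected graph with $n=|V|$ vertices (processes), diameter $D$, and a distinguished vertex $r$ (the root). $N(u)$ is the set of neighbors of $u$, $N[u]=N(u)\cup\{u\}$, and $dist(u)$ is the distance from $u$ to $r$. Each $u$ has variables $TS.u,P.u\in N(u)\cup\{\bot\}$, a color $C.u\in\{0,1\}$, a status $S.u\in\{Idle,Working,Power,WeakE,StrongE\}$ and a phase $ph.u\in\{a,b\}$; the root has no parent ($P.r=TS.r=\bot$) and $S.r\in\{Power,Working,StrongE\}$. A configuration is any assignment of values to these variables. $Erroneous=\{WeakE,StrongE\}$, $Child(u)=\{v\in N(u): P.v=u\}$; for a variable $X$, $X.P.u$ denotes the value of $X$ at the vertex $P.u$. **Predicates.** - StrongConflict($u$): $S.u\ne StrongE$ and there are $v,w\in N[u]$ with $C.v\neq C.w$ and $S.v=S.w=Power$. - Conflict($u$): either $u\ne r$, $P.u\neq\bot$ and some $v\in N(u)$ has $S.v=Power$, $C.v\ne C.u$; or $u=r$, $S.u\neq StrongE$ and some $v\in N(u)$ has $S.v=Power$ and ($C.v\ne C.u$ or $Child(u)=\emptyset$). - Detached($u$):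 $Child(u)=\emptyset$, ($P.u=\bot$ or $u=r$), $S.u\ne Power$. - StrongEReady($u$): $S.u=StrongE$ and no neighbor of $u$ has status $Power$. PowerFaulty($u$): $S.u=Power$ and some neighbor of $u$ has status $StrongE$. - Faulty($u$): $u\neq r$, $P.u\ne\bot$, $S.P.u\notin Erroneous$, and at least one of: $S.u\in Erroneous$; $C.u\ne C.P.u$; $S.P.u\neq Working$ and $S.u\ne Idle$; $S.P.u=S.u$ and $ph.u\neq ph.P.u$; $S.u=Power$ and $ph.u\ne ph.P.u$; $S.P.u=Power$ and ($Child(u)\ne\emptyset$ or $ph.u\neq ph.P.u$). - IllegalRoot($u$): $u\ne r$, $P.u=\bot$, not Detached($u$). IllegalLiveRoot($u$): IllegalRoot($u$) and $S.u\notin Erroneous$. IllegalChild($u$): $u\neq r$, $P.u\ne\bot$, $S.P.u\in Erroneous$. - Isolated($u$): $S.u\in\{WeakE,Working\}$ or StrongEReady($u$). - Ok($u$): none of StrongConflict, Conflict, PowerFaulty, Faulty, IllegalRoot, IllegalChild holds at $u$. - QuietSubTree($u$): every $v\in Child(u)$ has $S.v=Idle$ and $ph.v=ph.u$. EndFirstPhase($u$):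 $S.u=Power$, QuietSubTree($u$), and all neighbors of $u$ have color $C.u$. EndPhase($u$): $S.u=Working$ and QuietSubTree($u$). EndLastPhase($u$) (resp. EndIntermediatePhase($u$)): $Child(u)=\emptyset$ (resp. $\neq\emptyset$) and (EndFirstPhase($u$) or EndPhase($u$)). - Connection($u,v$): Detached($u$), (Isolated($u$) or $S.u=Idle$), $v\in N(u)$, $C.v\neq C.u$, $S.v=Power$. - NewPhase($u$): $P.u\ne\bot$, QuietSubTree($u$), $S.u=Idle$, $ph.u\neq ph.P.u$. **Rules of $r$.** RC1: $\neg$Conflict($r$), PowerFaulty($r$), QuietSubTree($r$) $\to S.r:=Working$. RC2: Detached($r$), StrongEReady($r$) $\to S.r:=Working$. RC3: Conflict($r$) $\to S.r:=StrongE$. R1: Ok($r$), EndLastPhase($r$), no neighbor with status $StrongE$ $\to C.r:=1-C.r$; $S.r:=Power$. R2: Ok($r$), EndIntermediatePhase($r$) $\to$ $ph.r$ changes; $S.r:=Working$. **Rules of $u\ne r$.** RC4: StrongConflict($u$) $\to S.u:=StrongE$; $P.u:=\bot$. RC5: $\neg$StrongConflict($u$) and (Conflict($u$) or Faulty($u$)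 or PowerFaulty($u$) or IllegalLiveRoot($u$) or IllegalChild($u$)) $\to S.u:=WeakE$; $P.u:=\bot$. RC6: Detached($u$), Isolated($u$), and every $v\in N(u)$ has $C.v=C.u$ or $S.v\neq Power$ $\to S.u:=Idle$. R3: Ok($u$), Connection($u,v$) for some $v$ $\to C.u:=C.v$; $ph.u:=ph.v$; $S.u:=Idle$; $P.u:=v$; $TS.u:=v$. R4: Ok($u$), NewPhase($u$), $Child(u)\neq\emptyset$ $\to ph.u:=ph.P.u$; $S.u:=Working$. R5: Ok($u$), NewPhase($u$), $Child(u)=\emptyset$, no neighbor with status $StrongE$ $\to ph.u:=ph.P.u$; $S.u:=Power$. R6: Ok($u$), EndIntermediatePhase($u$) $\to S.u:=Idle$. R7: Ok($u$), $P.u\ne\bot$, EndLastPhase($u$) $\to S.u:=Idle$; $P.u:=\bot$. **Executions and rounds.** A vertex is enabled if the guard of one of its rules holds. In a computation step an arbitrary nonempty set of enabled vertices (chosen by an unfair distributed daemon) simultaneously execute one enabled rule each. An execution is a maximal sequence of consecutive steps. The first round of an execution is its minimal prefix during which every vertex enabled at its start executes a rule or is neutralized (is disabled in the configuration reached by some step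 of the prefix); the second round is the first round of the remaining suffix, and so on. **Sets of configurations.** inLegalTree is the least predicate such that inLegalTree($r$) holds if $S.r\ne StrongE$, and inLegalTree($u$) holds if $P.u\neq\bot$, inLegalTree($P.u$) and $\neg$Faulty($u$). unRegular($u$): neither Detached($u$) nor inLegalTree($u$). PowerParent is the least predicate such that PowerParent($u$) holds if $P.u\ne\bot$, $S.u=Idle$ and either ($S.P.u=Working$ and $ph.u\neq ph.P.u$) or (PowerParent($P.u$) and $ph.u=ph.P.u$). influential($u$): $S.u=Power$ or PowerParent($u$). unSafe($u$): inLegalTree($u$), $S.u\neq Power$, $Child(u)\ne\emptyset$, and some $v\in N(u)$ is influential with $C.v\neq C.u$. $A4$ is the set of configurations in which every $u$ satisfies $\neg$Faulty($u$), $\neg$IllegalLiveRoot($u$), $\neg$unSafe($u$), ($\neg$influential($u$) or inLegalTree($u$)), and $S.u\ne StrongE$. correct($u$): $\neg$unRegular($u$), (inLegalTree($u$) or $S.u=Idle$), and ($u=r$ or ($TS.u\neq\bot$ and $dist(TS.u)<dist(u)$)). For $1\le k\le l\leq D+1$, $A4(k,l)$ is the set of configurations of $A4$ in which every $u$ satisfies: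 (i) if $dist(u)<l$ then correct($u$); (ii) if $dist(u)\le k-1$ then $C.u=C.r$; (iii) if $k<dist(u)\le l$ then $C.u\ne C.r$; (iv) if $dist(u)=k-1$ then either all $v\in N(u)$ have $C.v=C.r$, or influential($u$) and ($Child(u)=\emptyset$ or $S.u=Power$); (v) if $dist(u)=k$ then $C.u\neq C.r$, or [inLegalTree($u$), $\neg$influential($u$), $S.u=Idle$, $Child(u)=\emptyset$ and correct($u$)]; (vi) if $k\le dist(u)$ then $S.u\in\{Idle,Working,WeakE\}$. The set of legitimate configurations is $Al=\bigcup_{1\le k\le D+1}A4(k,D+1)$. **Theorem.** Every execution that starts from a configuration of $A4$ reaches a configuration of $Al$ within its first $(D+2)\,n\,(2n+3)$ rounds. -/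

import Mathlib

namespace BFSTree

/-- The five values of the status variable `S`. -/
inductive Status
  | idle
  | working
  | power
  | weakE
  | strongE

/-- The erroneous statuses. -/
def Status.Erroneous (s : Status) : Prop := s = .weakE ∨ s = .strongE

/-- Local state: the parent pointers `TS` and `P` (`none` stands for `⊥`), the color `C` in
`{0, 1}`, the status `S`, and the phase `ph` in `{a, b}` (both two-valued types are `Bool`). -/
structure LocalState (V : Type*) where
  TS : Option V
  P : Option V
  C : Bool
  S : Status
  ph : Bool

/-- A configuration: an arbitrary assignment of values to the variables, within their domains.
Pointers range over the neighbors and `⊥`; the root has no parent pointers (encoded by the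
constant `⊥`), and its status is never `Idle` or `WeakE`. -/
structure Config {V : Type*} (G : SimpleGraph V) (r : V) where
  st : V → LocalState V
  adj_P : ∀ u v, (st u).P = some v → G.Adj u v
  adj_TS : ∀ u v, (st u).TS = some v → G.Adj u v
  root_P : (st r).P = none
  root_TS : (st r).TS = none
  root_S : (st r).S = .power ∨ (st r).S = .working ∨ (st r).S = .strongE

namespace Config

variable {V : Type*} {G : SimpleGraph V} {r : V}

def TS (c : Config G r) (u : V) : Option V := (c.st u).TS
def P (c : Config G r) (u : V) : Option V := (c.st u).P
def C (c : Config G r) (u : V) : Bool := (c.st u).C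
def S (c : Config G r) (u : V) : Status := (c.st u).S
def ph (c : Config G r) (u : V) : Bool := (c.st u).ph

/-- The children of `u`. -/
def Child (c : Config G r) (u : V) : Set V := {v | G.Adj u v ∧ c.P v = some u}

/-- Two members of the closed neighborhood of `u` have the `Power` status and different colors. -/
def StrongConflict (c : Config G r) (u : V) : Prop :=
  c.S u ≠ .strongE ∧ ∃ w v, (w = u ∨ G.Adj u w) ∧ (v = u ∨ G.Adj u v) ∧
    c.C v ≠ c.C w ∧ c.S w = .power ∧ c.S v = .power

def Conflict (c : Config G r) (u : V) : Prop :=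
  (u ≠ r ∧ c.P u ≠ none ∧ ∃ v, G.Adj u v ∧ c.S v = .power ∧ c.C v ≠ c.C u) ∨
  (u = r ∧ c.S u ≠ .strongE ∧
    ∃ v, G.Adj u v ∧ c.S v = .power ∧ (c.C v ≠ c.C u ∨ c.Child u = ∅))

def Detached (c : Config G r) (u : V) : Prop :=
  c.Child u = ∅ ∧ (c.P u = none ∨ u = r) ∧ c.S u ≠ .power

def StrongEReady (c : Config G r) (u : V) : Prop :=
  c.S u = .strongE ∧ ∀ v, G.Adj u v → c.S v ≠ .power

def PowerFaulty (c : Config G r) (u : V) : Prop :=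
  c.S u = .power ∧ ∃ v, G.Adj u v ∧ c.S v = .strongE

def Faulty (c : Config G r) (u : V) : Prop :=
  u ≠ r ∧ ∃ p, c.P u = some p ∧ ¬ (c.S p).Erroneous ∧
    ((c.S u).Erroneous ∨
     c.C u ≠ c.C p ∨
     (c.S p ≠ .working ∧ c.S u ≠ .idle) ∨
     (c.S p = c.S u ∧ c.ph u ≠ c.ph p) ∨
     (c.S u = .power ∧ c.ph u ≠ c.ph p) ∨
     (c.S p = .power ∧ (c.Child u ≠ ∅ ∨ c.ph u ≠ c.ph p)))

def IllegalRoot (c : Config G r) (u : V) : Prop :=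
  u ≠ r ∧ c.P u = none ∧ ¬ c.Detached u

def IllegalLiveRoot (c : Config G r) (u : V) : Prop :=
  c.IllegalRoot u ∧ ¬ (c.S u).Erroneous

def IllegalChild (c : Config G r) (u : V) : Prop :=
  u ≠ r ∧ ∃ p, c.P u = some p ∧ (c.S p).Erroneous

def Isolated (c : Config G r) (u : V) : Prop :=
  c.S u = .weakE ∨ c.S u = .working ∨ c.StrongEReady u

def Ok (c : Config G r) (u : V) : Prop :=
  ¬ c.StrongConflict u ∧ ¬ c.Conflict u ∧ ¬ c.PowerFaulty u ∧ ¬ c.Faulty u ∧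
    ¬ c.IllegalRoot u ∧ ¬ c.IllegalChild u

def QuietSubTree (c : Config G r) (u : V) : Prop :=
  ∀ v ∈ c.Child u, c.S v = .idle ∧ c.ph v = c.ph u

def EndFirstPhase (c : Config G r) (u : V) : Prop :=
  c.S u = .power ∧ c.QuietSubTree u ∧ ∀ v, G.Adj u v → c.C v = c.C u

def EndPhase (c : Config G r) (u : V) : Prop :=
  c.S u = .working ∧ c.QuietSubTree u

def EndLastPhase (c : Config G r) (u : V) : Prop :=
  c.Child u = ∅ ∧ (c.EndFirstPhase u ∨ c.EndPhase u)

def EndIntermediatePhase (c : Config G r) (u : V) : Prop :=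
  c.Child u ≠ ∅ ∧ (c.EndFirstPhase u ∨ c.EndPhase u)

def Connection (c : Config G r) (u v : V) : Prop :=
  c.Detached u ∧ (c.Isolated u ∨ c.S u = .idle) ∧ G.Adj u v ∧ c.C v ≠ c.C u ∧ c.S v = .power

/-- `NewPhase(u)`, with `p` the parent of `u`. -/
def NewPhase (c : Config G r) (u p : V) : Prop :=
  c.P u = some p ∧ c.QuietSubTree u ∧ c.S u = .idle ∧ c.ph u ≠ c.ph p

/-- `c.Move u s`: in `c`, some rule is enabled at `u`, and executing it gives `u` the local
state `s`. `RC1`, `RC2`, `RC3`, `R1`, `R2` are the rules of the root, the others those of the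
other vertices. -/
inductive Move (c : Config G r) : V → LocalState V → Prop
  | RC1 : ¬ c.Conflict r → c.PowerFaulty r → c.QuietSubTree r →
      Move c r { c.st r with S := .working }
  | RC2 : c.Detached r → c.StrongEReady r →
      Move c r { c.st r with S := .working }
  | RC3 : c.Conflict r →
      Move c r { c.st r with S := .strongE }
  | RC4 (u : V) : u ≠ r → c.StrongConflict u →
      Move c u { c.st u with S := .strongE, P := none }
  | RC5 (u : V) : u ≠ r → ¬ c.StrongConflict u →
      (c.Conflict u ∨ c.Faulty u ∨ c.PowerFaulty u ∨ c.IllegalLiveRoot u ∨ c.IllegalChild u) →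
      Move c u { c.st u with S := .weakE, P := none }
  | RC6 (u : V) : u ≠ r → c.Detached u → c.Isolated u →
      (∀ v, G.Adj u v → c.C v = c.C u ∨ c.S v ≠ .power) →
      Move c u { c.st u with S := .idle }
  | R1 : c.Ok r → c.EndLastPhase r → (∀ v, G.Adj r v → c.S v ≠ .strongE) →
      Move c r { c.st r with C := !(c.C r), S := .power }
  | R2 : c.Ok r → c.EndIntermediatePhase r →
      Move c r { c.st r with ph := !(c.ph r), S := .working }
  | R3 (u v : V) : u ≠ r → c.Ok u → c.Connection u v →
      Move c u { C := c.C v, ph := c.ph v, S := .idle, P := some v, TS := some v }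
  | R4 (u p : V) : u ≠ r → c.Ok u → c.NewPhase u p → c.Child u ≠ ∅ →
      Move c u { c.st u with ph := c.ph p, S := .working }
  | R5 (u p : V) : u ≠ r → c.Ok u → c.NewPhase u p → c.Child u = ∅ →
      (∀ v, G.Adj u v → c.S v ≠ .strongE) →
      Move c u { c.st u with ph := c.ph p, S := .power }
  | R6 (u : V) : u ≠ r → c.Ok u → c.EndIntermediatePhase u →
      Move c u { c.st u with S := .idle }
  | R7 (u : V) : u ≠ r → c.Ok u → c.P u ≠ none → c.EndLastPhase u →
      Move c u { c.st u with S := .idle, P := none }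

def Enabled (c : Config G r) (u : V) : Prop := ∃ s, c.Move u s

/-- A computation step from `c` to `c'` in which exactly the vertices of the nonempty set `A`
move; the guards and the new values are evaluated in `c`. -/
def Step (c : Config G r) (A : Set V) (c' : Config G r) : Prop :=
  A.Nonempty ∧ ∀ u, (u ∈ A → c.Move u (c'.st u)) ∧ (u ∉ A → c'.st u = c.st u)

/-- Least predicate: `u` is on a branch of non-faulty vertices hanging from a root whose status
is not `StrongE`. -/
inductive InLegalTree (c : Config G r) : V → Prop
  | root : c.S r ≠ .strongE → InLegalTree c r
  | child (u p : V) : c.P u = some p → InLegalTree c p → ¬ c.Faulty u → InLegalTree c u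

def UnRegular (c : Config G r) (u : V) : Prop := ¬ c.Detached u ∧ ¬ c.InLegalTree u

inductive PowerParent (c : Config G r) : V → Prop
  | base (u p : V) : c.P u = some p → c.S u = .idle → c.S p = .working → c.ph u ≠ c.ph p →
      PowerParent c u
  | child (u p : V) : c.P u = some p → PowerParent c p → c.S u = .idle → c.ph u = c.ph p →
      PowerParent c u

def Influential (c : Config G r) (u : V) : Prop := c.S u = .power ∨ c.PowerParent u

def InsideLegalTree (c : Config G r) (u : V) : Prop :=
  c.InLegalTree u ∧ c.S u ≠ .power ∧ c.Child u ≠ ∅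

def UnSafe (c : Config G r) (u : V) : Prop :=
  c.InsideLegalTree u ∧ ∃ v, G.Adj u v ∧ c.C v ≠ c.C u ∧ c.Influential v

def InA1 (c : Config G r) : Prop := ∀ u, ¬ c.Faulty u ∧ ¬ c.IllegalLiveRoot u

def InA2 (c : Config G r) : Prop := c.InA1 ∧ ∀ u, ¬ c.UnSafe u

def InA3 (c : Config G r) : Prop := c.InA2 ∧ ∀ u, ¬ c.Influential u ∨ c.InLegalTree u

def InA4 (c : Config G r) : Prop := c.InA3 ∧ ∀ u, c.S u ≠ .strongE

/-- For `u ≠ r` the last clause says that `TS.u` is a neighbor of `u` strictly closer to `r`. -/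
def Correct (c : Config G r) (u : V) : Prop :=
  (¬ c.UnRegular u ∧ (c.InLegalTree u ∨ c.S u = .idle)) ∧
    (u = r ∨ ∃ p, c.TS u = some p ∧ G.dist p r < G.dist u r)

/-- The set `A4(k, l)`, for `1 ≤ k ≤ l`. -/
def InA4Layer (c : Config G r) (k l : ℕ) : Prop :=
  c.InA4 ∧ ∀ u,
    (G.dist u r < l → c.Correct u) ∧
    (G.dist u r + 1 ≤ k → c.C u = c.C r) ∧
    (k < G.dist u r ∧ G.dist u r ≤ l → c.C u ≠ c.C r) ∧
    (G.dist u r + 1 = k →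
      (∀ v, G.Adj u v → c.C v = c.C r) ∨
      (c.Influential u ∧ (c.Child u = ∅ ∨ c.S u = .power))) ∧
    (G.dist u r = k →
      c.C u ≠ c.C r ∨
      (c.InLegalTree u ∧ ¬ c.Influential u ∧ c.S u = .idle ∧ c.Child u = ∅ ∧ c.Correct u)) ∧
    (k ≤ G.dist u r → c.S u = .idle ∨ c.S u = .working ∨ c.S u = .weakE)

/-- The legitimate configurations: the union of the sets `A4(k, D + 1)`, `D` the diameter. -/
def InAl (c : Config G r) : Prop :=
  ∃ k, 1 ≤ k ∧ k ≤ G.diam + 1 ∧ c.InA4Layer k (G.diam + 1)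

end Config

/-- A maximal execution under the distributed unfair daemon: `cfg i` is the `i`-th configuration
and `act i` the set of vertices that move in the `i`-th step. An execution that reaches a
configuration without enabled vertex ends there, which is encoded by repeating it forever. -/
structure Execution {V : Type*} (G : SimpleGraph V) (r : V) where
  cfg : ℕ → Config G r
  act : ℕ → Set V
  step : ∀ i, (cfg i).Step (act i) (cfg (i + 1)) ∨
    ((∀ u, ¬ (cfg i).Enabled u) ∧ act i = ∅ ∧ cfg (i + 1) = cfg i)

namespace Execution

variable {V : Type*} {G : SimpleGraph V} {r : V}

/-- Each vertex enabled in `cfg i` moves or is neutralized in a step between `cfg i` and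
`cfg j`. -/
def Covers (e : Execution G r) (i j : ℕ) : Prop :=
  i ≤ j ∧ ∀ u, (e.cfg i).Enabled u →
    ∃ t, i ≤ t ∧ t < j ∧ (u ∈ e.act t ∨ ¬ (e.cfg (t + 1)).Enabled u)

/-- `e.RoundEnd k j`: the `k`-th round of `e` is finite and ends in `cfg j`. The first round is
the minimal prefix that covers the vertices enabled at its start, and round `k + 1` is the first
round of the suffix that starts where round `k` ends. -/
def RoundEnd (e : Execution G r) : ℕ → ℕ → Prop
  | 0, j => j = 0
  | k + 1, j => ∃ i, e.RoundEnd k i ∧ IsLeast {j | e.Covers i j} j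

/-- `cfg i` belongs to the prefix of `e` made of its first `N` rounds, i.e. it does not lie
beyond the end of the `N`-th round. -/
def WithinRounds (e : Execution G r) (N i : ℕ) : Prop :=
  ∀ j, e.RoundEnd N j → i ≤ j

end Execution

end BFSTree

/-!
In `A4` all influential vertices lie in the legal tree, whose vertices all have the color `C.r`.
Hence no two `Power` vertices have different colors, the status `StrongE` never appears, and only
nine of the rules can be executed (`Config.Moves`). In particular `A4` is closed
(`Config.InA4.step`), and outside the legal tree a vertex can only detach itself, become idle, and
join a `Power` vertex of the other color.

The root divides an execution into *phases*, which end when the root executes R1 or R2, and into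
*waves*, which end with R1, that is, when the root changes its color. During a wave colors change
only to `C.r`.

*Layers.* While the root executes neither rule, the set `A4(k, l)` is closed. With R2 the wave
passes from `A4(k, l)` to `A4(k + 1, l)`, and from `k = l` to a situation in which all vertices up
to distance `l` are correct and have the color `C.r`, which lasts until the wave ends; there all
vertices at distance `l + 1` have that color, too. So R1 leads to `A4(1, l + 1)`. This is recorded
by the predicate `Config.Wave` and its lemmas `step_of_stays`, `step_of_nextPhase` and
`step_of_flip`. The first R1 leads to `Wave 1 0`, hence `D + 2` waves lead to `A4(1, D + 1)`, a
subset of `Al`.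

*Rounds of a phase.* With `n` vertices, a phase lasts at most `2 n + 2` rounds
(`Execution.exists_root_move_of_covers`). The influence descends in the legal tree by one level in
each round; then, in three rounds, the neighbors of the `Power` vertices that have the other color
lose their parents, lose their children, and join; then the tree becomes idle from the leaves
upwards, one level in each round; finally the root moves.

*Phases of a wave.* There are at most `n` of them (`Execution.exists_flip`). After R2 all vertices
below the root are influential, so all leaves of the tree will become `Power`, and will then leave
the tree or get a child. If no vertex joined, the tree would have no leaf at the next R2. A vertex
joins at most once in a wave.

*Unfair daemon.* A round need not be finite. But between two moves of the root the sum of the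
weights `Config.weight` decreases with each step, so that the root moves infinitely often.
-/

namespace BFSTree

namespace Config

variable {V : Type*} {G : SimpleGraph V} {r : V} {c c' : Config G r} {u v w p : V}
  {k l d m : ℕ}

/-! ### Structure of the configurations of `A4` -/

theorem P_root (c : Config G r) : c.P r = none := c.root_P

theorem ne_root_of_P (h : c.P u = some p) : u ≠ r := by
  rintro rfl
  simp [c.P_root] at h

theorem mem_child_iff : w ∈ c.Child u ↔ c.P w = some u :=
  ⟨fun h => h.2, fun h => ⟨(c.adj_P w u h).symm, h⟩⟩

theorem child_ne_empty_of_P (h : c.P w = some u) : c.Child u ≠ ∅ :=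
  Set.nonempty_iff_ne_empty.1 ⟨w, mem_child_iff.2 h⟩

/-- What non-faultiness says along a parent edge `u → p` whose upper end is not erroneous. -/
theorem edge_of_not_faulty (hf : ¬ c.Faulty u) (hp : c.P u = some p)
    (he : ¬ (c.S p).Erroneous) :
    ¬ (c.S u).Erroneous ∧ c.C u = c.C p ∧ (c.S p = .working ∨ c.S u = .idle) ∧
      (c.S p = c.S u → c.ph u = c.ph p) ∧ (c.S u = .power → c.ph u = c.ph p) ∧
      (c.S p = .power → c.Child u = ∅ ∧ c.ph u = c.ph p) := by
  have hr := ne_root_of_P hp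
  simp only [Faulty, not_and, not_exists, not_or, not_not] at hf
  obtain ⟨h1, h2, h3, h4, h5, h6⟩ := hf hr p hp he
  exact ⟨h1, h2, by tauto, h4, h5, h6⟩

theorem not_faulty_of_edge (hp : c.P u = some p)
    (h : (c.S p).Erroneous ∨ (¬ (c.S u).Erroneous ∧ c.C u = c.C p ∧
      (c.S p = .working ∨ c.S u = .idle) ∧ (c.S p = c.S u → c.ph u = c.ph p) ∧
      (c.S u = .power → c.ph u = c.ph p) ∧
      (c.S p = .power → c.Child u = ∅ ∧ c.ph u = c.ph p))) : ¬ c.Faulty u := by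
  rintro ⟨-, q, hq, he, hf⟩
  obtain rfl : p = q := by simpa [hp] using hq
  tauto

theorem not_faulty_of_P_none (hp : c.P u = none) : ¬ c.Faulty u := by
  rintro ⟨-, q, hq, -⟩
  simp [hp] at hq

theorem InLegalTree.not_erroneous (h : c.InLegalTree u) : ¬ (c.S u).Erroneous := by
  induction h with
  | root h =>
    have := c.root_S
    change c.S r = _ ∨ c.S r = _ ∨ c.S r = _ at this
    rintro (h' | h') <;> simp_all
  | child u p hp _ hf ih => exact (edge_of_not_faulty hf hp ih).1

theorem InLegalTree.color (h : c.InLegalTree u) : c.C u = c.C r := by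
  induction h with
  | root h => rfl
  | child u p hp hl hf ih => rw [(edge_of_not_faulty hf hp hl.not_erroneous).2.1, ih]

theorem InLegalTree.parent (h : c.InLegalTree u) (hp : c.P u = some p) : c.InLegalTree p := by
  cases h with
  | root h => simp [c.P_root] at hp
  | child _ q hq hl hf =>
    obtain rfl : p = q := by simpa [hp] using hq
    exact hl

theorem InLegalTree.not_illegalChild (hl : c.InLegalTree u) : ¬ c.IllegalChild u := by
  rintro ⟨-, p, hp, he⟩
  exact (hl.parent hp).not_erroneous he

theorem InLegalTree.P_ne_none (h : c.InLegalTree u) (hu : u ≠ r) : c.P u ≠ none := by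
  cases h with
  | root h => exact absurd rfl hu
  | child _ q hq hl hf => simp [hq]

theorem InLegalTree.child_root_ne_empty (h : c.InLegalTree u) (hu : u ≠ r) :
    c.Child r ≠ ∅ := by
  induction h with
  | root h => exact absurd rfl hu
  | child u p hp hl hf ih =>
    by_cases hpr : p = r
    · subst hpr
      exact child_ne_empty_of_P hp
    · exact ih hpr

theorem PowerParent.idle (h : c.PowerParent u) : c.S u = .idle := by
  cases h <;> assumption

theorem PowerParent.ne_root (h : c.PowerParent u) : u ≠ r := by
  cases h <;> exact ne_root_of_P (by assumption)

theorem not_powerParent_root : ¬ c.PowerParent r := fun h => h.ne_root rfl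

namespace InA4

variable (h : c.InA4)
include h

theorem not_faulty (u : V) : ¬ c.Faulty u := (h.1.1.1 u).1

theorem not_illegalLiveRoot (u : V) : ¬ c.IllegalLiveRoot u := (h.1.1.1 u).2

theorem legal_of_influential (hu : c.Influential u) : c.InLegalTree u :=
  (h.1.2 u).resolve_left (not_not.2 hu)

theorem legal_of_power (hu : c.S u = .power) : c.InLegalTree u :=
  h.legal_of_influential (Or.inl hu)

theorem legal_of_powerParent (hu : c.PowerParent u) : c.InLegalTree u :=
  h.legal_of_influential (Or.inr hu)

theorem not_strongE (u : V) : c.S u ≠ .strongE := h.2 u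

theorem legal_root : c.InLegalTree r := .root (h.not_strongE r)

theorem legal_of_parent (hp : c.P u = some p) (hl : c.InLegalTree p) : c.InLegalTree u :=
  .child u p hp hl (h.not_faulty u)

theorem power_color (hu : c.S u = .power) : c.C u = c.C r := (h.legal_of_power hu).color

theorem erroneous_iff : (c.S u).Erroneous ↔ c.S u = .weakE := by
  simp [Status.Erroneous, h.not_strongE u]

theorem root_S : c.S r = .power ∨ c.S r = .working := by
  have := c.root_S
  change c.S r = _ ∨ c.S r = _ ∨ c.S r = _ at this
  have := h.not_strongE r
  tauto

/-- A non-root vertex without parent is detached, or has the status `WeakE`. -/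
theorem detached_or_weakE (hu : u ≠ r) (hp : c.P u = none) : c.Detached u ∨ c.S u = .weakE := by
  by_contra! hc
  refine h.not_illegalLiveRoot u ⟨⟨hu, hp, hc.1⟩, ?_⟩
  rw [h.erroneous_iff]
  exact hc.2

/-- The parent edges inside the legal tree. -/
theorem edge_of_not_weakE (hp : c.P u = some p) (he : c.S p ≠ .weakE) :
    c.S u ≠ .weakE ∧ c.C u = c.C p ∧ (c.S p = .working ∨ c.S u = .idle) ∧
      (c.S p = c.S u → c.ph u = c.ph p) ∧ (c.S u = .power → c.ph u = c.ph p) ∧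
      (c.S p = .power → c.Child u = ∅ ∧ c.ph u = c.ph p) := by
  have := edge_of_not_faulty (h.not_faulty u) hp (by rwa [h.erroneous_iff])
  rwa [h.erroneous_iff] at this

theorem edge_of_idle (hp : c.P u = some p) (he : c.S p = .idle) :
    c.S u = .idle ∧ c.ph u = c.ph p := by
  obtain ⟨-, -, h3, h4, -⟩ := h.edge_of_not_weakE hp (by simp [he])
  have : c.S u = .idle := by simpa [he] using h3
  exact ⟨this, h4 (by rw [he, this])⟩

theorem edge_of_power (hp : c.P u = some p) (he : c.S p = .power) :
    c.S u = .idle ∧ c.ph u = c.ph p ∧ c.Child u = ∅ := by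
  obtain ⟨-, -, h3, -, -, h4⟩ := h.edge_of_not_weakE hp (by simp [he])
  exact ⟨by simpa [he] using h3, (h4 he).2, (h4 he).1⟩

theorem not_weakE_of_legal (hl : c.InLegalTree u) :
    c.S u ≠ .weakE := by
  have := hl.not_erroneous
  rwa [h.erroneous_iff] at this

theorem not_strongConflict (u : V) : ¬ c.StrongConflict u := by
  rintro ⟨-, w, v, -, -, hC, hw, hv⟩
  exact hC (by rw [h.power_color hw, h.power_color hv])

theorem not_powerFaulty (u : V) : ¬ c.PowerFaulty u := by
  rintro ⟨-, v, -, hv⟩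
  exact h.not_strongE v hv

theorem not_conflict_of_legal (hl : c.InLegalTree u) : ¬ c.Conflict u := by
  rintro (⟨-, -, v, -, hv, hC⟩ | ⟨rfl, -, v, hadj, hv, hC | hC⟩)
  · exact hC (by rw [hl.color, h.power_color hv])
  · exact hC (h.power_color hv)
  · exact (h.legal_of_power hv).child_root_ne_empty hadj.ne' hC

theorem ok_of_legal (hl : c.InLegalTree u) : c.Ok u := by
  refine ⟨h.not_strongConflict u, h.not_conflict_of_legal hl, h.not_powerFaulty u,
    h.not_faulty u, ?_, hl.not_illegalChild⟩
  rintro ⟨hu, hp, -⟩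
  exact hl.P_ne_none hu hp

end InA4

/-- In `A4` the absence of unsafe vertices follows from the other conditions: influential vertices
lie in the legal tree, which has the single color `C.r`. -/
theorem inA4_of (h1 : ∀ u, ¬ c.Faulty u) (h2 : ∀ u, ¬ c.IllegalLiveRoot u)
    (h3 : ∀ u, c.Influential u → c.InLegalTree u) (h4 : ∀ u, c.S u ≠ .strongE) : c.InA4 := by
  refine ⟨⟨⟨fun u => ⟨h1 u, h2 u⟩, ?_⟩, fun u => ?_⟩, h4⟩
  · rintro u ⟨⟨hl, -, -⟩, v, -, hC, hi⟩
    exact hC (by rw [hl.color, (h3 v hi).color])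
  · have := h3 u
    tauto

/-! ### The moves that are possible in `A4` -/

/-- The local state of `u` in `c'`, listed by variables: status, parent, color, phase, `TS`. -/
def Becomes (c' : Config G r) (u : V) (s : Status) (p : Option V) (col ph : Bool)
    (t : Option V) : Prop :=
  c'.S u = s ∧ c'.P u = p ∧ c'.C u = col ∧ c'.ph u = ph ∧ c'.TS u = t

/-- `u` has the same local state in `c` and in `c'`. -/
def Stays (c c' : Config G r) (u : V) : Prop :=
  c'.Becomes u (c.S u) (c.P u) (c.C u) (c.ph u) (c.TS u)

theorem becomes_of_st {s : LocalState V} (hs : c'.st u = s) :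
    c'.Becomes u s.S s.P s.C s.ph s.TS :=
  ⟨congrArg _ hs, congrArg _ hs, congrArg _ hs, congrArg _ hs, congrArg _ hs⟩

/-- `c.Moves c' u`: what may happen to a vertex `u` that moves in a step from a configuration `c`
of `A4` to `c'`. The constructors `abort`, `reset`, `flip`, `nextPhase`, `join`, `descend`,
`empower`, `retreat`, `leave` are the rules RC5, RC6, R1, R2, R3, R4, R5, R6, R7 with the part of their
guards that matters. -/
inductive Moves (c c' : Config G r) (u : V) : Prop
  | abort : u ≠ r → ¬ c.InLegalTree u → c.P u ≠ none →
      c'.Becomes u .weakE none (c.C u) (c.ph u) (c.TS u) → Moves c c' u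
  | reset : u ≠ r → c.Detached u → (c.S u = .weakE ∨ c.S u = .working) →
      (∀ v, G.Adj u v → c.C v = c.C u ∨ c.S v ≠ .power) →
      c'.Becomes u .idle (c.P u) (c.C u) (c.ph u) (c.TS u) → Moves c c' u
  | flip : u = r → c.EndLastPhase r →
      c'.Becomes u .power (c.P u) (!(c.C u)) (c.ph u) (c.TS u) → Moves c c' u
  | nextPhase : u = r → c.EndIntermediatePhase r →
      c'.Becomes u .working (c.P u) (c.C u) (!(c.ph u)) (c.TS u) → Moves c c' u
  | join (v : V) : u ≠ r → c.Detached u → G.Adj u v → c.C v ≠ c.C u → c.S v = .power →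
      c'.Becomes u .idle (some v) (c.C v) (c.ph v) (some v) →
      Moves c c' u
  | descend (p : V) : c.P u = some p → c.S u = .idle → c.S p = .working → c.ph u ≠ c.ph p →
      c.Child u ≠ ∅ → c'.Becomes u .working (c.P u) (c.C u) (c.ph p) (c.TS u) → Moves c c' u
  | empower (p : V) : c.P u = some p → c.S u = .idle → c.S p = .working → c.ph u ≠ c.ph p →
      c.Child u = ∅ → c'.Becomes u .power (c.P u) (c.C u) (c.ph p) (c.TS u) → Moves c c' u
  | retreat : u ≠ r → c.Ok u → c.P u ≠ none → c.EndIntermediatePhase u →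
      c'.Becomes u .idle (c.P u) (c.C u) (c.ph u) (c.TS u) → Moves c c' u
  | leave : u ≠ r → c.Ok u → c.P u ≠ none → c.EndLastPhase u →
      c'.Becomes u .idle none (c.C u) (c.ph u) (c.TS u) → Moves c c' u

/-- What may happen to `u` in a step from a configuration `c` of `A4` to `c'`. -/
def Transition (c c' : Config G r) (u : V) : Prop := c.Stays c' u ∨ c.Moves c' u

theorem InA4.newPhase_parent_working (h : c.InA4) (hok : c.Ok u) (hn : c.NewPhase u p) :
    c.S p = .working := by
  obtain ⟨hp, -, hi, hph⟩ := hn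
  have hne : c.S p ≠ .weakE := fun hw =>
    hok.2.2.2.2.2 ⟨ne_root_of_P hp, p, hp, Or.inl hw⟩
  rcases hs : c.S p with _ | _ | _ | _ | _
  · exact absurd (h.edge_of_idle hp hs).2 hph
  · rfl
  · exact absurd (h.edge_of_power hp hs).2.1 hph
  · exact absurd hs hne
  · exact absurd hs (h.not_strongE p)

theorem InA4.moves_of_move (h : c.InA4) (hm : c.Move u (c'.st u)) : c.Moves c' u := by
  generalize hs : c'.st u = s at hm
  cases hm with
  | RC1 _ hf => exact absurd hf (h.not_powerFaulty r)
  | RC2 _ hf => exact absurd hf.1 (h.not_strongE r)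
  | RC3 hf => exact absurd hf (h.not_conflict_of_legal h.legal_root)
  | RC4 _ _ hf => exact absurd hf (h.not_strongConflict u)
  | RC5 _ hu _ hf =>
    rcases hf with hf | hf | hf | hf | hf
    · refine .abort hu (fun hl => h.not_conflict_of_legal hl hf) ?_ (becomes_of_st hs)
      rcases hf with hf | hf
      · exact hf.2.1
      · exact absurd hf.1 hu
    · exact absurd hf (h.not_faulty u)
    · exact absurd hf (h.not_powerFaulty u)
    · exact absurd hf (h.not_illegalLiveRoot u)
    · refine .abort hu (fun hl => hl.not_illegalChild hf) ?_ (becomes_of_st hs)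
      obtain ⟨-, p, hp, -⟩ := hf
      simp [hp]
  | RC6 _ hu hd hi hn =>
    refine .reset hu hd ?_ hn (becomes_of_st hs)
    rcases hi with hi | hi | hi
    · exact .inl hi
    · exact .inr hi
    · exact absurd hi.1 (h.not_strongE u)
  | R1 _ he _ => exact .flip rfl he (becomes_of_st hs)
  | R2 _ he => exact .nextPhase rfl he (becomes_of_st hs)
  | R3 _ v hu _ hcon =>
    exact .join v hu hcon.1 hcon.2.2.1 hcon.2.2.2.1 hcon.2.2.2.2
      (becomes_of_st hs)
  | R4 _ p hu hok hn hch =>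
    exact .descend p hn.1 hn.2.2.1 (h.newPhase_parent_working hok hn) hn.2.2.2 hch
      (becomes_of_st hs)
  | R5 _ p hu hok hn hch _ =>
    exact .empower p hn.1 hn.2.2.1 (h.newPhase_parent_working hok hn) hn.2.2.2 hch
      (becomes_of_st hs)
  | R6 _ hu hok he =>
    refine .retreat hu hok (fun hp => ?_) he (becomes_of_st hs)
    exact hok.2.2.2.2.1 ⟨hu, hp, fun hd => he.1 hd.1⟩
  | R7 _ hu hok hp he => exact .leave hu hok hp he (becomes_of_st hs)

theorem InA4.transition_of_step (h : c.InA4) {A : Set V} (hs : c.Step A c') (u : V) :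
    Transition c c' u := by
  by_cases hu : u ∈ A
  · exact .inr (h.moves_of_move ((hs.2 u).1 hu))
  · exact .inl (becomes_of_st ((hs.2 u).2 hu))

/-! ### Closure of `A4` -/

namespace InA4

variable (h : c.InA4) (hT : ∀ u, c.Transition c' u)
include h hT

/-- A `Power` vertex waits as long as one of its neighbors has the other color. -/
theorem stays_of_power (hv : c.S v = .power) (hadj : G.Adj v u) (hC : c.C u ≠ c.C v) :
    c.Stays c' v := by
  have key : ¬ (c.EndFirstPhase v ∨ c.EndPhase v) := by
    rintro (h' | h')
    · exact hC (h'.2.2 u hadj)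
    · simp [h'.1] at hv
  rcases hT v with hs | ⟨-, hl, -⟩ | ⟨-, hd, -⟩ | ⟨rfl, he, -⟩ | ⟨rfl, he, -⟩ | ⟨x, -, hd, -⟩ |
    ⟨p, -, hs, -⟩ | ⟨p, -, hs, -⟩ | ⟨-, -, -, he, -⟩ | ⟨-, -, -, he, -⟩
  · exact hs
  · exact absurd (h.legal_of_power hv) hl
  · exact absurd hv hd.2.2
  · exact absurd he.2 key
  · exact absurd he.2 key
  · exact absurd hv hd.2.2
  · simp [hs] at hv
  · simp [hs] at hv
  · exact absurd he.2 key
  · exact absurd he.2 key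

/-- An idle vertex with the phase of its parent does not move, unless it is cut off outside the
legal tree. -/
theorem stays_of_idle (hp : c.P u = some p) (hi : c.S u = .idle) (hph : c.ph u = c.ph p) :
    c.Stays c' u ∨ (¬ c.InLegalTree u ∧ c'.P u = none) := by
  have hu := ne_root_of_P hp
  have key : ¬ (c.EndFirstPhase u ∨ c.EndPhase u) := by
    rintro (h' | h')
    · simp [h'.1] at hi
    · simp [h'.1] at hi
  rcases hT u with hs | ⟨-, hl, -, hs⟩ | ⟨-, hd, -⟩ | ⟨rfl, he, -⟩ | ⟨rfl, he, -⟩ | ⟨x, -, hd, -⟩ |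
    ⟨p, hp', hs, -, hne, -⟩ | ⟨p, hp', hs, -, hne, -⟩ | ⟨-, -, -, he, -⟩ | ⟨-, -, -, he, -⟩
  · exact .inl hs
  · exact .inr ⟨hl, hs.2.1⟩
  · exact absurd hd.2.1 (by simp [hp, hu])
  · exact absurd rfl hu
  · exact absurd rfl hu
  · exact absurd hd.2.1 (by simp [hp, hu])
  · simp_all
  · simp_all
  · exact absurd he.2 key
  · exact absurd he.2 key

omit h in
/-- A parent edge of `c'` is a parent edge of `c`, or it is new and leads to a `Power` vertex of
the other color. -/
theorem _root_.BFSTree.Config.parent_back (hp : c'.P u = some p) :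
    c.P u = some p ∨ (c.Detached u ∧ G.Adj u p ∧ c.C p ≠ c.C u ∧ c.S p = .power ∧
      c'.Becomes u .idle (some p) (c.C p) (c.ph p) (some p)) := by
  rcases hT u with hs | ⟨-, hl, -, hs⟩ | ⟨-, hd, -, -, hs⟩ | ⟨-, he, hs⟩ | ⟨-, he, hs⟩ |
    ⟨x, -, hd, h1, h2, h3, hs⟩ | ⟨q, hp', -, -, hne, -, hs⟩ | ⟨q, hp', -, -, hne, -, hs⟩ |
    ⟨-, -, -, he, hs⟩ | ⟨-, -, -, he, hs⟩
  all_goals have hP := hs.2.1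
  all_goals rw [hp] at hP
  all_goals try exact .inl hP.symm
  all_goals cases hP
  exact .inr ⟨hd, h1, h2, h3, hs⟩

omit h in
theorem _root_.BFSTree.Config.child_eq_empty_step (hu : c.S u ≠ .power) (hc : c.Child u = ∅) :
    c'.Child u = ∅ := by
  refine Set.eq_empty_iff_forall_notMem.2 fun w hw => ?_
  rcases parent_back hT (mem_child_iff.1 hw) with hp | hp
  · exact child_ne_empty_of_P hp hc
  · exact hu hp.2.2.2.1

theorem weakE_step (hp : c.P u = some p) (he : c.S p = .weakE) : c'.S p = .weakE := by
  have hch := child_ne_empty_of_P hp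
  rcases hT p with hs | ⟨-, hl, -, hs⟩ | ⟨-, hd, -, -, hs⟩ | ⟨rfl, he', hs⟩ | ⟨rfl, he', hs⟩ |
    ⟨x, -, hd, h1, h2, h3, hs⟩ | ⟨q, hp', hi, -, hne, -, hs⟩ | ⟨q, hp', hi, -, hne, -, hs⟩ |
    ⟨-, -, -, he', hs⟩ | ⟨-, -, -, he', hs⟩
  · rw [hs.1, he]
  · exact hs.1
  · exact absurd hd.1 hch
  · exact absurd he'.1 hch
  · rcases he'.2 with h' | h' <;> simp [h'.1] at he
  · exact absurd hd.1 hch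
  · simp [hi] at he
  · simp [hi] at he
  · rcases he'.2 with h' | h' <;> simp [h'.1] at he
  · exact absurd he'.1 hch

/-- A parent edge keeps the shape that non-faultiness prescribes. -/
theorem edge_step (hp' : c'.P u = some p) :
    c'.S p = .weakE ∨ (c'.S u ≠ .weakE ∧ c'.C u = c'.C p ∧
      (c'.S p = .working ∨ c'.S u = .idle) ∧ (c'.S p = c'.S u → c'.ph u = c'.ph p) ∧
      (c'.S u = .power → c'.ph u = c'.ph p) ∧
      (c'.S p = .power → c'.Child u = ∅ ∧ c'.ph u = c'.ph p)) := by
  rcases parent_back hT hp' with hp | ⟨hd, hadj, hC, hpow, hs⟩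
  swap
  · have hst := h.stays_of_power hT hpow hadj.symm (Ne.symm hC)
    have hch := child_eq_empty_step hT hd.2.2 hd.1
    obtain ⟨h1, h2, h3, h4, h5⟩ := hs
    obtain ⟨k1, k2, k3, k4, k5⟩ := hst
    right
    simp [*]
  by_cases he : c.S p = .weakE
  · exact .inl (h.weakE_step hT hp he)
  have hu := ne_root_of_P hp
  have hch := child_ne_empty_of_P hp
  have hE := h.edge_of_not_weakE hp he
  have hq : c.QuietSubTree p → c.S u = .idle ∧ c.ph u = c.ph p :=
    fun hq => hq u (mem_child_iff.2 hp)
  have hemp := child_eq_empty_step (u := u) hT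
  have hTu : (c.Stays c' u) ∨ (c.S u = .idle ∧ c.S p = .working ∧ c.ph u ≠ c.ph p ∧
      (c'.S u = .working ∨ c'.S u = .power) ∧ c'.C u = c.C u ∧ c'.ph u = c.ph p) ∨
      (c'.S u = .idle ∧ c.S u ≠ .idle ∧ c'.C u = c.C u ∧ c'.ph u = c.ph u) := by
    rcases hT u with hs | ⟨-, hl, -, hs⟩ | ⟨-, hd, -, -, hs⟩ | ⟨rfl, he', hs⟩ | ⟨rfl, he', hs⟩ |
      ⟨x, -, hd, h1, h2, h3, hs⟩ | ⟨q, hp2, hi, hw, hne, -, hs⟩ | ⟨q, hp2, hi, hw, hne, -, hs⟩ |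
      ⟨-, -, -, he', hs⟩ | ⟨-, -, -, he', hs⟩
    · exact .inl hs
    · simp [hs.2.1] at hp'
    · exact absurd hd.2.1 (by simp [hp, hu])
    · exact absurd rfl hu
    · exact absurd rfl hu
    · exact absurd hd.2.1 (by simp [hp, hu])
    · obtain rfl : p = q := by simpa [hp] using hp2
      exact .inr (.inl ⟨hi, hw, hne, .inl hs.1, hs.2.2.1, hs.2.2.2.1⟩)
    · obtain rfl : p = q := by simpa [hp] using hp2
      exact .inr (.inl ⟨hi, hw, hne, .inr hs.1, hs.2.2.1, hs.2.2.2.1⟩)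
    · refine .inr (.inr ⟨hs.1, ?_, hs.2.2.1, hs.2.2.2.1⟩)
      rcases he'.2 with h' | h' <;> simp [h'.1]
    · simp [hs.2.1] at hp'
  have hTp : (c.Stays c' p) ∨ (c'.S p = .weakE) ∨
      ((c.S p = .idle ∨ c.QuietSubTree p) ∧ c'.S p = .working ∧ c'.C p = c.C p ∧
        c'.ph p ≠ c.ph p) ∨
      (c.QuietSubTree p ∧ c'.S p = .idle ∧ c'.C p = c.C p ∧ c'.ph p = c.ph p) := by
    rcases hT p with hs | ⟨-, hl, -, hs⟩ | ⟨-, hd, -, -, hs⟩ | ⟨rfl, he', hs⟩ | ⟨rfl, he', hs⟩ |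
      ⟨x, -, hd, h1, h2, h3, hs⟩ | ⟨q, hp2, hi, hw, hne, -, hs⟩ | ⟨q, hp2, hi, hw, hne, h0, hs⟩ |
      ⟨-, -, -, he', hs⟩ | ⟨-, -, -, he', hs⟩
    · exact .inl hs
    · exact .inr (.inl hs.1)
    · exact absurd hd.1 hch
    · exact absurd he'.1 hch
    · refine .inr (.inr (.inl ⟨.inr ?_, hs.1, hs.2.2.1, ?_⟩))
      · rcases he'.2 with h' | h'
        · exact h'.2.1
        · exact h'.2
      · rw [hs.2.2.2.1]; simp
    · exact absurd hd.1 hch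
    · exact .inr (.inr (.inl ⟨.inl hi, hs.1, hs.2.2.1, by rw [hs.2.2.2.1]; exact hne.symm⟩))
    · exact absurd h0 hch
    · refine .inr (.inr (.inr ⟨?_, hs.1, hs.2.2.1, hs.2.2.2.1⟩))
      rcases he'.2 with h' | h'
      · exact h'.2.1
      · exact h'.2
    · exact absurd he'.1 hch
  clear hT
  unfold Stays Becomes at hTu hTp
  have hidle : c.S p = .idle → c.S u = .idle ∧ c.ph u = c.ph p := h.edge_of_idle hp
  grind

theorem not_strongE_step (u : V) : c'.S u ≠ .strongE := by
  have := h.not_strongE u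
  rcases hT u with hs | ⟨-, -, -, hs⟩ | ⟨-, -, -, -, hs⟩ | ⟨-, -, hs⟩ | ⟨-, -, hs⟩ |
    ⟨_, -, -, -, -, -, hs⟩ | ⟨_, -, -, -, -, -, hs⟩ | ⟨_, -, -, -, -, -, hs⟩ |
    ⟨-, -, -, -, hs⟩ | ⟨-, -, -, -, hs⟩
  all_goals rw [hs.1]
  all_goals first | exact this | simp

theorem not_faulty_step (u : V) : ¬ c'.Faulty u := by
  cases hp : c'.P u with
  | none => exact not_faulty_of_P_none hp
  | some p =>
    by_cases hs : c'.S p = .strongE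
    · exact not_faulty_of_edge hp (.inl (.inr hs))
    rcases h.edge_step hT hp with he | ⟨he, hr⟩
    · exact not_faulty_of_edge hp (.inl (.inl he))
    · by_cases hs' : c'.S u = .strongE
      · exact absurd hs' (h.not_strongE_step hT u)
      · exact not_faulty_of_edge hp (.inr ⟨by rintro (h1 | h1) <;> contradiction, hr⟩)

theorem not_illegalLiveRoot_step (u : V) : ¬ c'.IllegalLiveRoot u := by
  rintro ⟨⟨hu, hp', hd'⟩, he'⟩
  rw [Status.Erroneous, not_or] at he'
  have hold : c.P u = none → c.Detached u ∨ c.S u = .weakE := h.detached_or_weakE hu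
  have hemp := child_eq_empty_step (u := u) hT
  have hpow : c.P u = none → c.S u ≠ .power := fun hp hpow =>
    (h.legal_of_power hpow).P_ne_none hu hp
  have key : c'.Child u = ∅ → c'.S u ≠ .power → False := fun h1 h2 => hd' ⟨h1, .inl hp', h2⟩
  rcases hT u with hs | ⟨-, hl, -, hs⟩ | ⟨-, hd, -, -, hs⟩ | ⟨rfl, he', hs⟩ | ⟨rfl, he', hs⟩ |
    ⟨x, -, hd, h1, h2, h3, hs⟩ | ⟨q, hp2, hi, hw, hne, -, hs⟩ | ⟨q, hp2, hi, hw, hne, -, hs⟩ |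
    ⟨-, -, hn, -, hs⟩ | ⟨-, -, hn, he2, hs⟩
  · have hp : c.P u = none := by rw [← hs.2.1, hp']
    rcases hold hp with hd | hw
    · exact key (hemp hd.2.2 hd.1) (by rw [hs.1]; exact hd.2.2)
    · exact he'.1 (by rw [hs.1, hw])
  · exact he'.1 hs.1
  · exact key (hemp hd.2.2 hd.1) (by simp [hs.1])
  · exact hu rfl
  · exact hu rfl
  · simp [hs.2.1] at hp'
  · simp [hs.2.1, hp2] at hp'
  · simp [hs.2.1, hp2] at hp'
  · exact hn (by rw [← hs.2.1, hp'])
  · refine key (Set.eq_empty_iff_forall_notMem.2 fun w hw => ?_) (by simp [hs.1])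
    rcases parent_back hT (mem_child_iff.1 hw) with hp | ⟨-, hadj, hC, hpow, -⟩
    · exact child_ne_empty_of_P hp he2.1
    · -- A `Power` vertex cannot leave while a neighbor of the other color joins it.
      have := (h.stays_of_power hT hpow hadj.symm (Ne.symm hC)).2.1
      rw [hp'] at this
      exact hn this.symm

/-- Vertices stay in the legal tree until they leave it by dropping their parent. -/
theorem legal_step (hl : c.InLegalTree u) (hp : u ≠ r → c'.P u ≠ none) : c'.InLegalTree u := by
  induction hl with
  | root => exact .root (h.not_strongE_step hT r)
  | child u p hpu hl _ ih =>
    have hu := ne_root_of_P hpu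
    have hp' : c'.P u = some p := by
      obtain ⟨q, hq⟩ := Option.ne_none_iff_exists'.1 (hp hu)
      rcases parent_back hT hq with hq' | ⟨hd, -⟩
      · rw [hq, ← hq', hpu]
      · rcases hd.2.1 with hd | hd
        · simp [hpu] at hd
        · exact absurd hd hu
    refine .child u p hp' (ih fun hpr => ?_) (h.not_faulty_step hT u)
    have hch := child_ne_empty_of_P hpu
    have hpn : c.P p ≠ none := hl.P_ne_none hpr
    rcases hT p with hs | ⟨-, hl', -, hs⟩ | ⟨-, hd, -, -, hs⟩ | ⟨h1, -⟩ | ⟨h1, -⟩ |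
      ⟨x, -, hd, -⟩ | ⟨q, -, -, -, -, -, hs⟩ | ⟨q, -, -, -, -, -, hs⟩ |
      ⟨-, -, -, -, hs⟩ | ⟨-, -, -, he, hs⟩
    · rwa [hs.2.1]
    · exact absurd hl hl'
    · rwa [hs.2.1]
    · exact absurd h1 hpr
    · exact absurd h1 hpr
    · exact absurd hd.1 hch
    · rwa [hs.2.1]
    · rwa [hs.2.1]
    · rwa [hs.2.1]
    · exact absurd he.1 hch

theorem legal_of_join (hp : c'.P u = some p) (hpow : c.S p = .power) (hadj : G.Adj u p)
    (hC : c.C p ≠ c.C u) : c'.InLegalTree u := by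
  have hl := h.legal_of_power hpow
  refine .child u p hp (h.legal_step hT hl fun hpr => ?_) (h.not_faulty_step hT u)
  rw [(h.stays_of_power hT hpow hadj.symm hC.symm).2.1]
  exact hl.P_ne_none hpr

/-- A vertex of the legal tree of `c'` was already there, or it has just joined a `Power`
vertex. -/
theorem legal_back (hl : c'.InLegalTree u) :
    c.InLegalTree u ∨ ∃ p, (u ≠ r ∧ c.Detached u ∧ G.Adj u p ∧ c.C p ≠ c.C u ∧ c.S p = .power ∧
      c'.Becomes u .idle (some p) (c.C p) (c.ph p) (some p)) := by
  induction hl with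
  | root => exact .inl h.legal_root
  | child u p hpu hl _ ih =>
    rcases parent_back hT hpu with hp | hp
    · rcases ih with ih | ⟨q, hpr, hd, -⟩
      · exact .inl (h.legal_of_parent hp ih)
      · exact absurd hd.1 (child_ne_empty_of_P hp)
    · exact .inr ⟨p, ne_root_of_P hpu, hp⟩

/-- As long as the root does not start a new phase, no vertex becomes influential. -/
theorem powerParent_back (hpp : c'.PowerParent u) :
    c.PowerParent u ∨ (c.InLegalTree u ∧ c.EndIntermediatePhase r ∧ c'.S r = .working ∧
      c'.ph r ≠ c.ph r) := by
  induction hpp with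
  | base u p hp' hi' hw' hph' =>
    rcases parent_back hT hp' with hp | ⟨hd, hadj, hC, hpow, hs⟩
    swap
    · have := (h.stays_of_power hT hpow hadj.symm (Ne.symm hC)).1
      simp [this, hpow] at hw'
    have hch := child_ne_empty_of_P hp
    have hu := ne_root_of_P hp
    -- The child `u` of a vertex that is `Working` in `c`.
    have hwork : c.S p = .working → c.ph p = c'.ph p → c.PowerParent u := by
      intro hw hph
      have hE := h.edge_of_not_weakE hp (by simp [hw])
      rcases hT u with hs | ⟨-, hl', -, hs⟩ | ⟨-, hd, -, -, hs⟩ | ⟨h1, -⟩ | ⟨h1, -⟩ |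
        ⟨x, -, hd, -⟩ | ⟨q, -, -, -, -, -, hs⟩ | ⟨q, -, -, -, -, -, hs⟩ |
        ⟨-, -, -, he, hs⟩ | ⟨-, -, -, he, hs⟩
      · exact .base u p hp (by rw [← hs.1, hi']) hw (by rwa [hph, ← hs.2.2.2.1])
      · simp [hs.2.1] at hp'
      · exact absurd hd.2.1 (by simp [hp, hu])
      · exact absurd h1 hu
      · exact absurd h1 hu
      · exact absurd hd.2.1 (by simp [hp, hu])
      · simp [hs.1] at hi'
      · simp [hs.1] at hi'
      · exfalso
        refine hph' ?_
        rw [hs.2.2.2.1, ← hph]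
        rcases he.2 with h' | h'
        · exact hE.2.2.2.2.1 h'.1
        · exact hE.2.2.2.1 (by rw [hw, h'.1])
      · simp [hs.2.1] at hp'
    rcases hT p with hs | ⟨-, hl', -, hs⟩ | ⟨-, hd, -, -, hs⟩ | ⟨rfl, he, hs⟩ | ⟨rfl, he, hs⟩ |
      ⟨x, -, hd, -⟩ | ⟨q, hpq, hi, hwq, hne, -, hs⟩ | ⟨q, -, -, -, -, he, hs⟩ |
      ⟨-, -, -, he, hs⟩ | ⟨-, -, -, he, hs⟩
    · exact .inl (hwork (by rw [← hs.1, hw']) hs.2.2.2.1.symm)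
    · simp [hs.1] at hw'
    · exact absurd hd.1 hch
    · exact absurd he.1 hch
    · exact .inr ⟨h.legal_of_parent hp h.legal_root, he, hw', by simp [hs.2.2.2.1]⟩
    · exact absurd hd.1 hch
    · have hE := h.edge_of_idle hp hi
      exact .inl (.child u p hp (.base p q hpq hi hwq hne) hE.1 hE.2)
    · exact absurd he hch
    · simp [hs.1] at hw'
    · exact absurd he.1 hch
  | child u p hp' hpp' hi' hph' ih =>
    rcases parent_back hT hp' with hp | ⟨hd, hadj, hC, hpow, hs⟩
    swap
    · have := (h.stays_of_power hT hpow hadj.symm (Ne.symm hC)).1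
      have hi2 := hpp'.idle
      simp [this, hpow] at hi2
    rcases ih with ih | ⟨hl, ih⟩
    · have hE := h.edge_of_idle hp ih.idle
      exact .inl (.child u p hp ih hE.1 hE.2)
    · exact .inr ⟨h.legal_of_parent hp hl, ih⟩

theorem legal_of_powerParent_step (hpp : c'.PowerParent u) : c'.InLegalTree u := by
  have hl : c.InLegalTree u := by
    rcases h.powerParent_back hT hpp with h1 | h1
    · exact h.legal_of_powerParent h1
    · exact h1.1
  refine h.legal_step hT hl fun _ => ?_
  cases hpp <;> simp [*]

theorem power_back (hpow : c'.S u = .power) :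
    c.S u = .power ∨ (c.PowerParent u ∧ c.Child u = ∅) ∨ (u = r ∧ c.EndLastPhase r) := by
  rcases hT u with hs | ⟨-, hl', -, hs⟩ | ⟨-, hd, -, -, hs⟩ | ⟨h1, he, hs⟩ | ⟨rfl, he, hs⟩ |
    ⟨x, -, hd, -, -, -, hs⟩ | ⟨q, hpq, hi, hwq, hne, -, hs⟩ | ⟨q, hpq, hi, hwq, hne, he, hs⟩ |
    ⟨-, -, -, he, hs⟩ | ⟨-, -, -, he, hs⟩
  · exact .inl (by rw [← hs.1, hpow])
  · simp [hs.1] at hpow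
  · simp [hs.1] at hpow
  · exact .inr (.inr ⟨h1, he⟩)
  · simp [hs.1] at hpow
  · simp [hs.1] at hpow
  · simp [hs.1] at hpow
  · exact .inr (.inl ⟨.base u q hpq hi hwq hne, he⟩)
  · simp [hs.1] at hpow
  · simp [hs.1] at hpow

/-- The set `A4` is closed. -/
theorem step : c'.InA4 := by
  refine inA4_of (h.not_faulty_step hT) (h.not_illegalLiveRoot_step hT) ?_
    (h.not_strongE_step hT)
  rintro u (hpow | hpp)
  · have hl : c.InLegalTree u := by
      rcases h.power_back hT hpow with h1 | h1 | h1
      · exact h.legal_of_power h1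
      · exact h.legal_of_powerParent h1.1
      · rw [h1.1]; exact h.legal_root
    refine h.legal_step hT hl fun hu hp => ?_
    rcases hT u with hs | ⟨-, hl', -, hs⟩ | ⟨-, hd, -, -, hs⟩ | ⟨h1, he, hs⟩ | ⟨rfl, he, hs⟩ |
      ⟨x, -, hd, -, -, -, hs⟩ | ⟨q, hpq, hi, hwq, hne, -, hs⟩ | ⟨q, hpq, hi, hwq, hne, he, hs⟩ |
      ⟨-, -, -, he, hs⟩ | ⟨-, -, -, he, hs⟩
    all_goals have hS := hs.1
    all_goals have hP := hs.2.1
    all_goals first | contradiction | skip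
    · exact hl.P_ne_none hu (by rw [← hP, hp])
    all_goals simp_all
  · exact h.legal_of_powerParent_step hT hpp

end InA4

/-! ### Persistence of influence and the moves of the root -/

/-- Either the root does not move, or it starts a new wave, or it starts a new phase of the
current wave. -/
theorem root_cases (hT : c.Transition c' r) : c.Stays c' r ∨
    (c.EndLastPhase r ∧ c'.Becomes r .power (c.P r) (!(c.C r)) (c.ph r) (c.TS r)) ∨
    (c.EndIntermediatePhase r ∧ c'.Becomes r .working (c.P r) (c.C r) (!(c.ph r)) (c.TS r)) := by
  rcases hT with hs | ⟨hr, -⟩ | ⟨hr, -⟩ | ⟨-, he, hs⟩ | ⟨-, he, hs⟩ | ⟨_, hr, -⟩ |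
    ⟨q, hp, -⟩ | ⟨q, hp, -⟩ | ⟨hr, -⟩ | ⟨hr, -⟩
  · exact .inl hs
  · exact absurd rfl hr
  · exact absurd rfl hr
  · exact .inr (.inl ⟨he, hs⟩)
  · exact .inr (.inr ⟨he, hs⟩)
  · exact absurd rfl hr
  · simp [c.P_root] at hp
  · simp [c.P_root] at hp
  · exact absurd rfl hr
  · exact absurd rfl hr

theorem eq_root_of_legal (hch : c.Child r = ∅) (hl : c.InLegalTree u) : u = r := by
  by_contra hu
  exact hl.child_root_ne_empty hu hch

theorem quiet_of_end (he : c.EndFirstPhase u ∨ c.EndPhase u) : c.QuietSubTree u := by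
  rcases he with he | he
  · exact he.2.1
  · exact he.2

theorem color_cases (hT : ∀ u, c.Transition c' u) (u : V) : c'.C u = c.C u ∨
    (u = r ∧ c.EndLastPhase r) ∨
    ∃ v, u ≠ r ∧ c.Detached u ∧ G.Adj u v ∧ c.C v ≠ c.C u ∧ c.S v = .power ∧
      c'.Becomes u .idle (some v) (c.C v) (c.ph v) (some v) := by
  rcases hT u with hs | ⟨-, -, -, hs⟩ | ⟨-, -, -, -, hs⟩ | ⟨hr, he, hs⟩ | ⟨-, -, hs⟩ |
    ⟨v, h1, h2, h3, h4, h5, hs⟩ | ⟨q, -, -, -, -, -, hs⟩ | ⟨q, -, -, -, -, -, hs⟩ |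
    ⟨-, -, -, -, hs⟩ | ⟨-, -, -, -, hs⟩
  · exact .inl hs.2.2.1
  · exact .inl hs.2.2.1
  · exact .inl hs.2.2.1
  · exact .inr (.inl ⟨hr, he⟩)
  · exact .inl hs.2.2.1
  · exact .inr (.inr ⟨v, h1, h2, h3, h4, h5, hs⟩)
  · exact .inl hs.2.2.1
  · exact .inl hs.2.2.1
  · exact .inl hs.2.2.1
  · exact .inl hs.2.2.1

namespace InA4

variable (h : c.InA4) (hT : ∀ u, c.Transition c' u)
include h

/-- When the subtree of the root is quiet, the whole legal tree waits for the root. -/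
theorem idle_of_quiet_root (hq : c.QuietSubTree r) (hl : c.InLegalTree u) (hu : u ≠ r) :
    c.S u = .idle ∧ ¬ c.PowerParent u ∧ ∃ p, c.P u = some p ∧ c.ph u = c.ph p := by
  induction hl with
  | root => exact absurd rfl hu
  | child u p hp hl _ ih =>
    by_cases hpr : p = r
    · subst hpr
      have := hq u (mem_child_iff.2 hp)
      refine ⟨this.1, fun hpp => ?_, p, hp, this.2⟩
      cases hpp with
      | base _ q hq hi hw hph =>
        obtain rfl : p = q := by simpa [hp] using hq
        exact hph this.2
      | child _ q hq hpp =>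
        obtain rfl : p = q := by simpa [hp] using hq
        exact not_powerParent_root hpp
    · have ih := ih hpr
      have hE := h.edge_of_idle hp ih.1
      refine ⟨hE.1, fun hpp => ?_, p, hp, hE.2⟩
      cases hpp with
      | base _ q hq hi hw hph =>
        obtain rfl : p = q := by simpa [hp] using hq
        exact hph hE.2
      | child _ q hq hpp =>
        obtain rfl : p = q := by simpa [hp] using hq
        exact ih.2.1 hpp

/-- A non-influential idle vertex of the legal tree has the phase of its parent. -/
theorem ph_eq_of_not_powerParent (hl : c.InLegalTree u) (hi : c.S u = .idle)
    (hpp : ¬ c.PowerParent u) (hp : c.P u = some p) : c.ph u = c.ph p := by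
  have hlp := hl.parent hp
  have hE := h.edge_of_not_weakE hp (h.not_weakE_of_legal hlp)
  by_contra hne
  rcases hs : c.S p with _ | _ | _ | _ | _
  · exact hne (hE.2.2.2.1 (by rw [hs, hi]))
  · exact hpp (.base u p hp hi hs hne)
  · exact hne (hE.2.2.2.2.2 hs).2
  · exact h.not_weakE_of_legal hlp hs
  · exact h.not_strongE p hs

include hT

theorem stays_of_not_powerParent (hl : c.InLegalTree u) (hu : u ≠ r) (hi : c.S u = .idle)
    (hpp : ¬ c.PowerParent u) : c.Stays c' u := by
  obtain ⟨p, hp⟩ := Option.ne_none_iff_exists'.1 (hl.P_ne_none hu)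
  rcases h.stays_of_idle hT hp hi (h.ph_eq_of_not_powerParent hl hi hpp hp) with hs | hs
  · exact hs
  · exact absurd hl hs.1

/-- Starting a new phase at the root makes the whole legal tree influential. -/
theorem powerParent_of_nextPhase (hq : c.QuietSubTree r) (hw : c'.S r = .working)
    (hph : c'.ph r = !(c.ph r)) (hl : c.InLegalTree u) (hu : u ≠ r) : c'.PowerParent u := by
  induction hl with
  | root => exact absurd rfl hu
  | child u p hp hl hf ih =>
    have hlu : c.InLegalTree u := .child u p hp hl hf
    obtain ⟨hi, hpp, q, hpq, hphq⟩ := h.idle_of_quiet_root hq hlu hu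
    obtain rfl : p = q := by simpa [hp] using hpq
    obtain ⟨h1, h2, -, h4, -⟩ := h.stays_of_not_powerParent hT hlu hu hi hpp
    by_cases hpr : p = r
    · subst hpr
      exact .base u p (by rw [h2, hp]) (by rw [h1, hi]) hw (by rw [h4, hphq, hph]; simp)
    · obtain ⟨hi', hpp', -⟩ := h.idle_of_quiet_root hq hl hpr
      have hs := h.stays_of_not_powerParent hT hl hpr hi' hpp'
      exact .child u p (by rw [h2, hp]) (ih hpr) (by rw [h1, hi])
        (by rw [h4, hphq, hs.2.2.2.1])

/-- An influential idle vertex remains influential until it moves. -/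
theorem powerParent_step (hpp : c.PowerParent u) (hs : c.Stays c' u) : c'.PowerParent u := by
  induction hpp with
  | base u p hp hi hw hph =>
    have hl : c.InLegalTree p := (h.legal_of_powerParent (.base u p hp hi hw hph)).parent hp
    have hq : ¬ c.QuietSubTree p := fun hq => hph (hq u (mem_child_iff.2 hp)).2
    have hch := child_ne_empty_of_P hp
    have hsp : c.Stays c' p := by
      rcases hT p with hs | ⟨-, hl', -⟩ | ⟨-, hd, -⟩ | ⟨rfl, he, -⟩ | ⟨rfl, he, -⟩ |
        ⟨x, -, hd, -⟩ | ⟨p, -, hs, -⟩ | ⟨p, -, hs, -⟩ | ⟨-, -, -, he, -⟩ | ⟨-, -, -, he, -⟩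
      · exact hs
      · exact absurd hl hl'
      · exact absurd hd.1 hch
      · exact absurd he.1 hch
      · exact absurd (quiet_of_end he.2) hq
      · exact absurd hd.1 hch
      · simp [hs] at hw
      · simp [hs] at hw
      · exact absurd (quiet_of_end he.2) hq
      · exact absurd he.1 hch
    refine .base u p ?_ ?_ ?_ ?_
    · rw [hs.2.1, hp]
    · rw [hs.1, hi]
    · rw [hsp.1, hw]
    · rwa [hs.2.2.2.1, hsp.2.2.2.1]
  | child u p hp hpp hi hph ih =>
    have hl : c.InLegalTree p := h.legal_of_powerParent hpp
    have hch := child_ne_empty_of_P hp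
    have hpi := hpp.idle
    have hend : ¬ (c.EndFirstPhase p ∨ c.EndPhase p) := by
      rintro (h' | h') <;> simp [h'.1] at hpi
    rcases hT p with hsp | ⟨-, hl', -⟩ | ⟨-, hd, -⟩ | ⟨rfl, he, -⟩ | ⟨rfl, he, -⟩ |
      ⟨x, -, hd, -⟩ | ⟨q, hpq, -, hw, hne, -, hsp⟩ | ⟨q, -, -, -, -, he, -⟩ |
      ⟨-, -, -, he, -⟩ | ⟨-, -, -, he, -⟩
    · refine .child u p ?_ (ih hsp) ?_ ?_
      · rw [hs.2.1, hp]
      · rw [hs.1, hi]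
      · rw [hs.2.2.2.1, hsp.2.2.2.1, hph]
    · exact absurd hl hl'
    · exact absurd hd.1 hch
    · exact absurd he.1 hch
    · exact absurd he.2 hend
    · exact absurd hd.1 hch
    · refine .base u p ?_ ?_ hsp.1 ?_
      · rw [hs.2.1, hp]
      · rw [hs.1, hi]
      · rwa [hs.2.2.2.1, hsp.2.2.2.1, hph]
    · exact absurd he hch
    · exact absurd he.2 hend
    · exact absurd he.1 hch

theorem powerParent_back_of_stays (hr : c.Stays c' r) (hpp : c'.PowerParent u) :
    c.PowerParent u := by
  rcases h.powerParent_back hT hpp with h1 | ⟨-, -, -, h1⟩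
  · exact h1
  · exact absurd hr.2.2.2.1 h1

/-! ### Colors and correctness -/

/-- During a wave the color of the root is permanent. -/
theorem color_step (hu : u ≠ r) (hC : c.C u = c.C r) : c'.C u = c.C r := by
  rcases color_cases hT u with h1 | ⟨h1, -⟩ | ⟨v, -, -, -, h1, h2, -⟩
  · rw [h1, hC]
  · exact absurd h1 hu
  · exact absurd (h.power_color h2) (by rwa [← hC])

theorem correct_root : c'.Correct r :=
  have hl := (h.step hT).legal_root
  ⟨⟨fun hr => hr.2 hl, .inl hl⟩, .inl rfl⟩

theorem correct_of_join (hadj : G.Adj u v) (hC : c.C v ≠ c.C u)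
    (hpow : c.S v = .power) (hs : c'.Becomes u .idle (some v) (c.C v) (c.ph v) (some v))
    (hd : G.dist v r < G.dist u r) : c'.Correct u :=
  have hl := h.legal_of_join hT hs.2.1 hpow hadj hC
  ⟨⟨fun hr => hr.2 hl, .inl hl⟩, .inr ⟨v, hs.2.2.2.2, hd⟩⟩

/-- Correctness is permanent for a vertex that can join only vertices closer to the root. -/
theorem correct_step (hc : c.Correct u)
    (hj : ∀ v, G.Adj u v → c.C v ≠ c.C u → c.S v = .power → G.dist v r < G.dist u r) :
    c'.Correct u := by
  by_cases hu : u = r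
  · subst hu; exact h.correct_root hT
  have h' := h.step hT
  obtain ⟨⟨h1, h2⟩, h3⟩ := hc
  have h3 := h3.resolve_left hu
  have hl1 : c.InLegalTree u → c'.P u ≠ none → c'.InLegalTree u :=
    fun hl hp => h.legal_step hT hl fun _ => hp
  have h1 : c.Detached u ∨ c.InLegalTree u := by
    by_contra hc
    exact h1 (not_or.1 hc)
  have hdet : c.Detached u → c.P u = none := fun hd => hd.2.1.resolve_right hu
  -- A vertex that drops its parent becomes detached, as there are no illegal live roots.
  have hfin : c'.P u = none → c'.S u = .idle → c'.Correct u ∨ c'.TS u ≠ c.TS u := by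
    intro hp hi
    by_cases hts : c'.TS u = c.TS u
    · have hd := (h'.detached_or_weakE hu hp).resolve_right (by simp [hi])
      exact .inl ⟨⟨fun hr => hr.1 hd, .inr hi⟩, .inr (by rwa [hts])⟩
    · exact .inr hts
  have hleg : c'.InLegalTree u → c'.TS u = c.TS u → c'.Correct u := fun hl hts =>
    ⟨⟨fun hr => hr.2 hl, .inl hl⟩, .inr (by rwa [hts])⟩
  rcases hT u with hs | ⟨-, hl', hP, -⟩ | ⟨-, hd, hS, -, hs⟩ | ⟨h1, -⟩ | ⟨h1, -⟩ |
    ⟨v, -, hd, hadj, hC, hpow, hs⟩ | ⟨q, hP, -, -, -, -, hs⟩ | ⟨q, hP, -, -, -, -, hs⟩ |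
    ⟨-, -, hP, -, hs⟩ | ⟨-, -, hP, -, hs⟩
  · by_cases hl : c.InLegalTree u
    · exact hleg (hl1 hl (by rw [hs.2.1]; exact hl.P_ne_none hu)) hs.2.2.2.2
    · have hi : c.S u = .idle := h2.resolve_left hl
      refine (hfin ?_ (by rw [hs.1, hi])).resolve_right (by simp [hs.2.2.2.2])
      rw [hs.2.1, hdet (h1.resolve_right hl)]
  · exact absurd (hdet (h1.resolve_right hl')) hP
  · exfalso
    rcases h2 with hl | hi
    · exact hl.P_ne_none hu (hdet hd)
    · simp [hi] at hS
  · exact absurd h1 hu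
  · exact absurd h1 hu
  · exact h.correct_of_join hT hadj hC hpow hs (hj v hadj hC hpow)
  · refine hleg (hl1 (h1.resolve_left fun hd => ?_) (by simp [hs.2.1, hP])) hs.2.2.2.2
    simp [hdet hd] at hP
  · refine hleg (hl1 (h1.resolve_left fun hd => ?_) (by simp [hs.2.1, hP])) hs.2.2.2.2
    simp [hdet hd] at hP
  · refine hleg (hl1 (h1.resolve_left fun hd => ?_) (by simp [hs.2.1, hP])) hs.2.2.2.2
    simp [hdet hd] at hP
  · exact (hfin hs.2.1 hs.1).resolve_right (by simp [hs.2.2.2.2])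

end InA4

/-! ### The layers reached by a wave -/

/-- The invariant of the `l`-th complete wave. The vertices at distance less than `k` have been
reached, and if `k ≤ l` those at distance `k` are being reached, all of them from distance
`k - 1`, and those at larger distance up to `l` have the previous color. The value `k = l + 1`
stands for the rest of the wave, about which nothing more has to be known. -/
structure Wave (c : Config G r) (k l : ℕ) : Prop where
  inA4 : c.InA4
  one_le : 1 ≤ k
  le_succ : k ≤ l + 1
  correct : ∀ u, G.dist u r < l ∨ G.dist u r < k → c.Correct u
  inner : ∀ u, G.dist u r < k → c.C u = c.C r
  outer : ∀ u, k < G.dist u r → G.dist u r ≤ l → c.C u ≠ c.C r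
  rim : ∀ u, G.dist u r + 1 = k → (∀ v, G.Adj u v → c.C v = c.C r) ∨
    (c.Influential u ∧ (c.Child u = ∅ ∨ c.S u = .power))
  front : k ≤ l → ∀ u, G.dist u r = k → c.C u ≠ c.C r ∨
    (c.InLegalTree u ∧ ¬ c.Influential u ∧ c.S u = .idle ∧ c.Child u = ∅ ∧ c.Correct u)

theorem dist_le_of_adj (hG : G.Connected) (hadj : G.Adj u v) : G.dist u r ≤ G.dist v r + 1 := by
  have h1 := hG.dist_triangle (u := u) (v := v) (w := r)
  rw [SimpleGraph.dist_eq_one_iff_adj.2 hadj] at h1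
  omega

theorem exists_adj_dist (hG : G.Connected) (hu : u ≠ r) :
    ∃ v, G.Adj u v ∧ G.dist v r + 1 = G.dist u r := by
  obtain ⟨q, hq⟩ := (hG u r).exists_walk_length_eq_dist
  cases q with
  | nil => exact absurd rfl hu
  | @cons _ v _ hadj q =>
    refine ⟨v, hadj, ?_⟩
    have h1 := SimpleGraph.dist_le q
    have h2 := dist_le_of_adj (r := r) hG hadj
    simp only [SimpleGraph.Walk.length_cons] at hq
    omega

theorem exists_dist_eq (hG : G.Connected) (hk : k ≤ G.dist u r) : ∃ v, G.dist v r = k := by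
  induction hm : G.dist u r - k generalizing u with
  | zero => exact ⟨u, by omega⟩
  | succ m ih =>
    have hu : u ≠ r := by
      rintro rfl
      simp at hm
    obtain ⟨v, -, hv⟩ := exists_adj_dist hG hu
    exact ih (u := v) (by omega) (by omega)

namespace Wave

theorem dist_le (hG : G.Connected) (hW : c.Wave k l) (hk : k ≤ l) (hl : c.InLegalTree u) :
    G.dist u r ≤ k := by
  induction hl with
  | root => simp
  | child u p hp hl _ ih =>
    have h1 := dist_le_of_adj (r := r) hG (c.adj_P u p hp)
    by_contra hlt
    rcases hW.front hk p (by omega) with hC | hC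
    · exact hC hl.color
    · exact child_ne_empty_of_P hp hC.2.2.2.1

theorem power_dist_lt (hG : G.Connected) (hW : c.Wave k l) (hk : k ≤ l) (hp : c.S u = .power) :
    G.dist u r < k := by
  have hl := hW.inA4.legal_of_power hp
  refine lt_of_le_of_ne (hW.dist_le hG hk hl) fun hd => ?_
  rcases hW.front hk u hd with hC | hC
  · exact hC hl.color
  · exact hC.2.1 (.inl hp)

theorem inA4Layer (hG : G.Connected) (hW : c.Wave k l) (hk : k ≤ l) : c.InA4Layer k l := by
  refine ⟨hW.inA4, fun u => ⟨fun hu => hW.correct u (.inl hu), fun hu => hW.inner u hu,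
    fun hu => hW.outer u hu.1 hu.2, hW.rim u, hW.front hk u, fun hu => ?_⟩⟩
  rcases hs : c.S u with _ | _ | _ | _ | _
  · exact .inl rfl
  · exact .inr (.inl rfl)
  · exact absurd (hW.power_dist_lt hG hk hs) (by omega)
  · exact .inr (.inr rfl)
  · exact absurd hs (hW.inA4.not_strongE u)

/-- In the controlled layers a vertex is joined only from the previous layer. -/
theorem dist_lt_of_join (hG : G.Connected) (hW : c.Wave k l)
    (hd : G.dist u r < l ∨ G.dist u r < k ∨ k ≤ l) (hC : c.C v ≠ c.C u) (hp : c.S v = .power) :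
    G.dist v r < k ∧ k ≤ G.dist u r := by
  have h1 : ¬ G.dist u r < k := fun hlt =>
    hC (by rw [hW.inner u hlt, hW.inA4.power_color hp])
  have := hW.le_succ
  exact ⟨hW.power_dist_lt hG (by omega) hp, by omega⟩

/-- When the root moves, the vertices at distance `k` have all been reached. -/
theorem color_eq_of_end (hG : G.Connected) (hW : c.Wave k l)
    (he : c.EndFirstPhase r ∨ c.EndPhase r) (hd : G.dist u r = k) : c.C u = c.C r := by
  have h := hW.inA4
  have := hW.one_le
  obtain ⟨w, hadj, hw⟩ := exists_adj_dist (u := u) (r := r) hG (by rintro rfl; simp at hd; omega)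
  rcases hW.rim w (by omega) with h1 | ⟨h1, -⟩
  · exact h1 u hadj.symm
  have hl := h.legal_of_influential h1
  by_cases hwr : w = r
  · subst hwr
    rcases h1 with h1 | h1
    · rcases he with he | he
      · exact he.2.2 u hadj.symm
      · simp [he.1] at h1
    · exact absurd h1 not_powerParent_root
  · exfalso
    obtain ⟨hi, hpp, -⟩ := h.idle_of_quiet_root (quiet_of_end he) hl hwr
    rcases h1 with h1 | h1
    · simp [hi] at h1
    · exact hpp h1

variable (hG : G.Connected) (hT : ∀ u, c.Transition c' u)
include hG hT

theorem correct_step (hW : c.Wave k l) (hu : G.dist u r < l ∨ G.dist u r < k) :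
    c'.Correct u := by
  refine hW.inA4.correct_step hT (hW.correct u hu) fun v _ hC hp => ?_
  have := hW.dist_lt_of_join hG (u := u) (by omega) hC hp
  omega

theorem outer_step (hW : c.Wave k l) (h1 : k < G.dist u r) (h2 : G.dist u r ≤ l)
    (hr : c'.C r = c.C r) : c'.C u ≠ c'.C r := by
  rw [hr]
  rcases color_cases hT u with hC | ⟨rfl, -⟩ | ⟨v, -, -, hadj, hC, hp, -⟩
  · rw [hC]; exact hW.outer u h1 h2
  · simp at h1
  · have := (hW.dist_lt_of_join hG (.inr (.inr (by omega))) hC hp).1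
    have := dist_le_of_adj (r := r) hG hadj
    omega

theorem step_of_stays (hW : c.Wave k l) (hr : c.Stays c' r) : c'.Wave k l := by
  have h := hW.inA4
  have hcr : c'.C r = c.C r := hr.2.2.1
  have hcol : ∀ u, c.C u = c.C r → c'.C u = c'.C r := by
    intro u hu
    by_cases hur : u = r
    · rw [hur]
    · rw [hcr, h.color_step hT hur hu]
  refine ⟨h.step hT, hW.one_le, hW.le_succ, fun u => hW.correct_step hG hT,
    fun u hu => hcol u (hW.inner u hu), fun u h1 h2 => hW.outer_step hG hT h1 h2 hcr,
    fun u hu => ?_, fun hk u hu => ?_⟩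
  · rcases hW.rim u hu with h1 | ⟨h1, h2⟩
    · exact .inl fun v hv => hcol v (h1 v hv)
    have hl := h.legal_of_influential h1
    have hcu := hW.inner u (by omega)
    have hemp := child_eq_empty_step (u := u) hT
    have hend : c.EndFirstPhase u ∨ c.EndPhase u → ∀ v, G.Adj u v → c'.C v = c'.C r := by
      rintro (he | he) v hv
      · exact hcol v (by rw [he.2.2 v hv, hcu])
      · rcases h1 with h1 | h1
        · simp [he.1] at h1
        · have := h1.idle
          simp [he.1] at this
    have hdet : ¬ c.Detached u := by
      intro hd
      rcases h1 with h1 | h1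
      · exact hd.2.2 h1
      · exact hd.2.1.elim (hl.P_ne_none h1.ne_root) h1.ne_root
    rcases hT u with hs | ⟨-, hl', -⟩ | ⟨-, hd, -⟩ | ⟨rfl, he, -⟩ | ⟨rfl, he, -⟩ |
      ⟨x, -, hd, -⟩ | ⟨q, -, hi, -, -, hch, hs⟩ | ⟨q, -, -, -, -, he, hs⟩ |
      ⟨-, -, -, he, -⟩ | ⟨-, -, -, he, -⟩
    · by_cases hpow : c.S u = .power
      · exact .inr ⟨.inl (by rw [hs.1, hpow]), .inr (by rw [hs.1, hpow])⟩
      · exact .inr ⟨.inr (h.powerParent_step hT (h1.resolve_left hpow) hs),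
          .inl (hemp hpow (h2.resolve_right hpow))⟩
    · exact absurd hl hl'
    · exact absurd hd hdet
    · exact .inl (hend he.2)
    · exact .inl (hend he.2)
    · exact absurd hd hdet
    · exact absurd (h2.resolve_right (by simp [hi])) hch
    · exact .inr ⟨.inl hs.1, .inr hs.1⟩
    · exact .inl (hend he.2)
    · exact .inl (hend he.2)
  · have hur : u ≠ r := by
      rintro rfl
      have := hW.one_le
      simp at hu
      omega
    have hpb := h.powerParent_back_of_stays hT hr (u := u)
    rcases hW.front hk u hu with h1 | ⟨h1, h2, h3, h4, h5⟩
    · rcases color_cases hT u with hC | ⟨hC, -⟩ | ⟨v, -, hd, hadj, hC, hp, hs⟩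
      · exact .inl (by rwa [hC, hcr])
      · exact absurd hC hur
      · refine .inr ⟨h.legal_of_join hT hs.2.1 hp hadj hC, ?_, hs.1,
          child_eq_empty_step hT hd.2.2 hd.1, h.correct_of_join hT hadj hC hp hs ?_⟩
        · rintro (hi | hi)
          · simp [hs.1] at hi
          · exact h1 (h.legal_of_powerParent (hpb hi)).color
        · have := hW.dist_lt_of_join hG (.inr (.inr hk)) hC hp
          omega
    · have hs := h.stays_of_not_powerParent hT h1 hur h3 (fun hpp => h2 (.inr hpp))
      refine .inr ⟨h.legal_step hT h1 fun _ => ?_, ?_, by rw [hs.1, h3],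
        child_eq_empty_step hT (by simp [h3]) h4, h.correct_step hT h5 fun v _ hC hp => ?_⟩
      · rw [hs.2.1]; exact h1.P_ne_none hur
      · rintro (hi | hi)
        · simp [hs.1, h3] at hi
        · exact h2 (.inr (hpb hi))
      · exact absurd (by rw [h.power_color hp, h1.color]) hC

/-- A new phase of the root extends the controlled part of the wave by one layer. -/
theorem step_of_nextPhase (hW : c.Wave k l) (he : c.EndIntermediatePhase r)
    (hr : c'.Becomes r .working (c.P r) (c.C r) (!(c.ph r)) (c.TS r)) :
    ∃ k', c'.Wave k' l := by
  have h := hW.inA4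
  have hcr : c'.C r = c.C r := hr.2.2.1
  have hone := hW.one_le
  have hle := hW.le_succ
  have hq := quiet_of_end he.2
  have hcol : ∀ u, c.C u = c.C r → c'.C u = c'.C r := by
    intro u hu
    by_cases hur : u = r
    · rw [hur]
    · rw [hcr, h.color_step hT hur hu]
  have hend := fun u => hW.color_eq_of_end hG he.2 (u := u)
  by_cases hk : k ≤ l
  · have hfront : ∀ u, G.dist u r = k → c.InLegalTree u ∧ u ≠ r ∧ c.S u = .idle ∧
        c.Child u = ∅ ∧ c.Correct u := by
      intro u hu
      obtain ⟨h1, -, h2, h3, h4⟩ := (hW.front hk u hu).resolve_left (not_not.2 (hend u hu))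
      refine ⟨h1, ?_, h2, h3, h4⟩
      rintro rfl
      simp at hu
      omega
    refine ⟨k + 1, h.step hT, by omega, by omega, fun u hu => ?_, fun u hu => ?_,
      fun u h1 h2 => hW.outer_step hG hT (by omega) h2 hcr, fun u hu => ?_, fun hk' u hu => ?_⟩
    · by_cases hu' : G.dist u r = k
      · refine h.correct_step hT (hfront u hu').2.2.2.2 fun v _ hC hp => ?_
        exact absurd (by rw [h.power_color hp, hend u hu']) hC
      · exact hW.correct_step hG hT (by omega)
    · by_cases hu' : G.dist u r = k
      · exact hcol u (hend u hu')
      · exact hcol u (hW.inner u (by omega))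
    · obtain ⟨h1, h2, h3, h4, -⟩ := hfront u (by omega)
      exact .inr ⟨.inr (h.powerParent_of_nextPhase hT hq hr.1 hr.2.2.2.1 h1 h2),
        .inl (child_eq_empty_step hT (by simp [h3]) h4)⟩
    · exact .inl (hW.outer_step hG hT (by omega) (by omega) hcr)
  · refine ⟨k, h.step hT, hone, hle, fun u => hW.correct_step hG hT,
      fun u hu => hcol u (hW.inner u hu), fun u h1 h2 => by omega, fun u hu => .inl ?_,
      fun hk' => absurd hk' hk⟩
    intro v hv
    by_cases hv' : G.dist v r = k
    · exact hcol v (hend v hv')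
    · have := dist_le_of_adj (r := r) hG hv.symm
      exact hcol v (hW.inner v (by omega))

/-- The wave after the `l`-th complete one starts with one more controlled layer. -/
theorem step_of_flip (hW : c.Wave k l) (he : c.EndLastPhase r)
    (hr : c'.Becomes r .power (c.P r) (!(c.C r)) (c.ph r) (c.TS r)) : c'.Wave 1 (l + 1) := by
  have h := hW.inA4
  have hle := hW.le_succ
  have hend := fun u => hW.color_eq_of_end hG he.2 (u := u)
  have hzero : ∀ u, G.dist u r < 1 → u = r := fun u hu =>
    (hG.dist_eq_zero_iff).1 (by omega)
  -- If the layer `k ≤ l` were not empty, its vertices would be in the legal tree, which is `{r}`.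
  have hlow : k ≤ l → ∀ u, G.dist u r < k := by
    intro hk u
    by_contra hu
    obtain ⟨v, hv⟩ := exists_dist_eq (u := u) (r := r) (k := k) hG (by omega)
    obtain ⟨h1, -⟩ := (hW.front hk v hv).resolve_left (not_not.2 (hend v hv))
    obtain rfl := eq_root_of_legal he.1 h1
    have := hW.one_le
    simp at hv
    omega
  have hcol : ∀ u, G.dist u r ≤ l + 1 → u ≠ r → c'.C u ≠ c'.C r := by
    intro u hu hur
    have hC : c.C u = c.C r := by
      by_cases hk : k ≤ l
      · exact hW.inner u (hlow hk u)
      · by_cases hu' : G.dist u r = k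
        · exact hend u hu'
        · exact hW.inner u (by omega)
    rw [h.color_step hT hur hC, hr.2.2.1]
    simp
  refine ⟨h.step hT, le_rfl, by omega, fun u hu => ?_, fun u hu => by rw [hzero u hu],
    fun u h1 h2 => hcol u h2 ?_, fun u hu => ?_, fun _ u hu => .inl (hcol u (by omega) ?_)⟩
  · by_cases hk : k ≤ l
    · exact hW.correct_step hG hT (.inr (hlow hk u))
    · exact hW.correct_step hG hT (by omega)
  · rintro rfl
    simp at h1
  · obtain rfl := hzero u (by omega)
    exact .inr ⟨.inl hr.1, .inr hr.1⟩
  · rintro rfl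
    simp at hu

end Wave

/-- The first wave that starts at the root is controlled at the root only. -/
theorem InA4.wave_of_flip (hG : G.Connected) (h : c.InA4) (hT : ∀ u, c.Transition c' u)
    (hr : c'.Becomes r .power (c.P r) (!(c.C r)) (c.ph r) (c.TS r)) : c'.Wave 1 0 := by
  have hzero : ∀ u, G.dist u r < 1 → u = r := fun u hu =>
    (hG.dist_eq_zero_iff).1 (by omega)
  refine ⟨h.step hT, le_rfl, le_rfl, fun u hu => ?_, fun u hu => by rw [hzero u hu],
    fun u h1 h2 => by omega, fun u hu => ?_, fun h0 => by omega⟩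
  · obtain rfl := hzero u (by omega)
    exact h.correct_root hT
  · obtain rfl := hzero u (by omega)
    exact .inr ⟨.inl hr.1, .inr hr.1⟩

/-! ### Depth in the legal tree -/

/-- `c.AtDepth d u`: the parent pointers lead from `u` to the root in exactly `d` steps. -/
inductive AtDepth (c : Config G r) : ℕ → V → Prop
  | root : AtDepth c 0 r
  | child (d : ℕ) (u p : V) : c.P u = some p → AtDepth c d p → AtDepth c (d + 1) u

theorem InLegalTree.exists_atDepth (h : c.InLegalTree u) : ∃ d, c.AtDepth d u := by
  induction h with
  | root => exact ⟨0, .root⟩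
  | child u p hp _ _ ih =>
    obtain ⟨d, hd⟩ := ih
    exact ⟨d + 1, .child d u p hp hd⟩

theorem AtDepth.legal (hd : c.AtDepth d u) (h : c.InA4) : c.InLegalTree u := by
  induction hd with
  | root => exact h.legal_root
  | child d u p hp _ ih => exact h.legal_of_parent hp ih

theorem AtDepth.eq_root (hd : c.AtDepth 0 u) : u = r := by
  cases hd; rfl

theorem AtDepth.ne_root (hd : c.AtDepth (d + 1) u) : u ≠ r := by
  cases hd with
  | child _ _ p hp _ => exact ne_root_of_P hp

theorem AtDepth.parent (hd : c.AtDepth (d + 1) u) (hp : c.P u = some p) : c.AtDepth d p := by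
  cases hd with
  | child _ _ q hq hd =>
    obtain rfl : p = q := by simpa [hp] using hq
    exact hd

theorem AtDepth.unique {d' : ℕ} (hd : c.AtDepth d u) (hd' : c.AtDepth d' u) : d = d' := by
  induction hd generalizing d' with
  | root =>
    cases d' with
    | zero => rfl
    | succ d' => exact absurd rfl hd'.ne_root
  | child d u p hp _ ih =>
    cases d' with
    | zero => exact absurd hd'.eq_root (ne_root_of_P hp)
    | succ d' => rw [ih (hd'.parent hp)]

theorem AtDepth.exists_of_le (hd : c.AtDepth d u) (hm : m ≤ d) : ∃ v, c.AtDepth m v := by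
  induction hd with
  | root => exact ⟨r, by obtain rfl : m = 0 := by omega
                         exact .root⟩
  | child d u p hp hd ih =>
    rcases hm.lt_or_eq with hm | rfl
    · exact ih (by omega)
    · exact ⟨u, .child d u p hp hd⟩

theorem AtDepth.lt_card [Fintype V] (hd : c.AtDepth d u) : d < Fintype.card V := by
  choose f hf using fun i : Fin (d + 1) => hd.exists_of_le (Nat.lt_succ_iff.1 i.2)
  have hinj : Function.Injective f := fun i j hij =>
    Fin.ext ((hf i).unique (hij ▸ hf j))
  simpa using Fintype.card_le_of_injective f hinj

/-! ### Steps in which the root rests -/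

/-- A step between configurations of `A4` in which the root does not move. -/
structure RootFree (c c' : Config G r) : Prop where
  inA4 : c.InA4
  trans : ∀ u, c.Transition c' u
  root : c.Stays c' r

namespace RootFree

variable (hR : c.RootFree c')
include hR

theorem inA4' : c'.InA4 := hR.inA4.step hR.trans

theorem powerParent_back (hpp : c'.PowerParent u) : c.PowerParent u :=
  hR.inA4.powerParent_back_of_stays hR.trans hR.root hpp

theorem power_back (hpow : c'.S u = .power) : c.S u = .power ∨ c.PowerParent u := by
  rcases hR.inA4.power_back hR.trans hpow with h | h | ⟨rfl, -⟩
  · exact .inl h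
  · exact .inr h.1
  · exact .inl (by rw [← hR.root.1, hpow])

theorem color_back (hC : c'.C u ≠ c'.C r) : c.C u ≠ c.C r := by
  intro hC'
  by_cases hu : u = r
  · exact hC (by rw [hu])
  · exact hC (by rw [hR.inA4.color_step hR.trans hu hC', hR.root.2.2.1])

/-- A parent edge below a vertex that had not been reached by the wave is old. -/
theorem parent_back (hp : c'.P u = some p) (hC : c'.C u ≠ c'.C r ∨ c'.C p ≠ c'.C r) :
    c.P u = some p := by
  rcases Config.parent_back hR.trans hp with hp' | ⟨-, -, -, hpow, hs⟩
  · exact hp'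
  · have h := hR.inA4.power_color hpow
    rcases hC with hC | hC
    · exact absurd (by rw [hs.2.2.1, h, hR.root.2.2.1]) hC
    · exact absurd h (hR.color_back hC)

theorem atDepth_back (hd : c'.AtDepth d u) (hu : u ≠ r → ¬ c.Detached u) : c.AtDepth d u := by
  induction hd with
  | root => exact .root
  | child d u p hp' _ ih =>
    rcases Config.parent_back hR.trans hp' with hp | hp
    · exact .child d u p hp (ih fun _ hd => child_ne_empty_of_P hp hd.1)
    · exact absurd hp.1 (hu (ne_root_of_P hp'))

theorem powerParent_atDepth_back (hpp : c'.PowerParent u) (hd : c'.AtDepth d u) :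
    c.AtDepth d u := by
  have hl := hR.inA4.legal_of_powerParent (hR.powerParent_back hpp)
  exact hR.atDepth_back hd fun hu hdet => hl.P_ne_none hu (hdet.2.1.resolve_right hu)

/-- Without influential vertices, a vertex of the legal tree that is not idle was not idle
before. -/
theorem not_idle_back (hpp : ∀ u, ¬ c.PowerParent u) (hd : c'.AtDepth (d + 1) u)
    (hi : c'.S u ≠ .idle) : c.AtDepth (d + 1) u ∧ c.S u ≠ .idle := by
  have hu := hd.ne_root
  have hd' : c.AtDepth (d + 1) u := by
    refine hR.atDepth_back hd fun _ hdet => ?_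
    obtain ⟨p, hp⟩ := Option.ne_none_iff_exists'.1 ((hd.legal hR.inA4').P_ne_none hu)
    rcases Config.parent_back hR.trans hp with hp' | hp'
    · simp [hdet.2.1.resolve_right hu] at hp'
    · exact hi hp'.2.2.2.2.1
  refine ⟨hd', fun hi' => hi ?_⟩
  rw [(hR.inA4.stays_of_not_powerParent hR.trans (hd'.legal hR.inA4) hu hi' (hpp u)).1, hi']

end RootFree

/-! ### The stages of a phase

A phase is the part of a computation between two moves of the root. It runs through stages. Each
of them is a condition `Q` that root-free steps preserve, and each ends within one round. -/

/-- In the stage `Q` the vertices `u` that satisfy `X u` are enabled until they move, after which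
`X u` is false forever. -/
structure Advances (Q : Config G r → Prop) (X : V → Config G r → Prop) : Prop where
  stable : ∀ c c', c.RootFree c' → Q c → Q c'
  back : ∀ u c c', c.RootFree c' → Q c → X u c' → X u c
  enabled : ∀ u c, c.InA4 → Q c → X u c → c.Enabled u
  moves : ∀ u c c', c.RootFree c' → Q c → X u c → c.Moves c' u → ¬ X u c'

theorem Advances.stable_and {Q : Config G r → Prop} {X : V → Config G r → Prop}
    (hQ : Advances Q X) (c c' : Config G r) (hR : c.RootFree c') (h : Q c ∧ ∀ u, ¬ X u c) :
    Q c' ∧ ∀ u, ¬ X u c' :=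
  ⟨hQ.stable c c' hR h.1, fun u hX => h.2 u (hQ.back u c c' hR h.1 hX)⟩

/-- No idle influential vertex has depth at most `m`. -/
def CalmTo (m : ℕ) (c : Config G r) : Prop := ∀ u d, d ≤ m → c.AtDepth d u → ¬ c.PowerParent u

/-- No idle vertex is influential. -/
def Calm (c : Config G r) : Prop := ∀ u, ¬ c.PowerParent u

/-- A vertex with a parent that has to join the wave. -/
def Attached (u : V) (c : Config G r) : Prop :=
  c.C u ≠ c.C r ∧ c.P u ≠ none ∧ ∃ v, G.Adj u v ∧ c.S v = .power

/-- A child of a vertex that has to join the wave. -/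
def BelowJoining (w : V) (c : Config G r) : Prop :=
  ∃ u, c.P w = some u ∧ c.C u ≠ c.C r ∧ ∃ v, G.Adj u v ∧ c.S v = .power

/-- A vertex that has to join the wave. -/
def Joining (u : V) (c : Config G r) : Prop :=
  c.C u ≠ c.C r ∧ ∃ v, G.Adj u v ∧ c.S v = .power

/-- The wave has passed all vertices of depth at least `m`. -/
def IdleFrom (m : ℕ) (c : Config G r) : Prop :=
  ∀ u d, m ≤ d → c.AtDepth (d + 1) u → c.S u = .idle

/-- The influence descends by one level in each round. -/
theorem advances_calmTo (m : ℕ) : Advances (G := G) (r := r) (CalmTo m)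
    (fun u c => c.PowerParent u ∧ c.AtDepth (m + 1) u) where
  stable c c' hR hQ u d hm hd hpp :=
    hQ u d hm (hR.powerParent_atDepth_back hpp hd) (hR.powerParent_back hpp)
  back u c c' hR _ hX := ⟨hR.powerParent_back hX.1, hR.powerParent_atDepth_back hX.1 hX.2⟩
  enabled u c h hQ hX := by
    obtain ⟨hpp, hd⟩ := hX
    have hl := h.legal_of_powerParent hpp
    cases hpp with
    | base _ p hp hi hw hph =>
      have hn : c.NewPhase u p :=
        ⟨hp, fun w hw => h.edge_of_idle (mem_child_iff.1 hw) hi, hi, hph⟩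
      by_cases hch : c.Child u = ∅
      · exact ⟨_, .R5 u p (ne_root_of_P hp) (h.ok_of_legal hl) hn hch
          fun v _ => h.not_strongE v⟩
      · exact ⟨_, .R4 u p (ne_root_of_P hp) (h.ok_of_legal hl) hn hch⟩
    | child _ p hp hpp hi hph => exact absurd hpp (hQ p m le_rfl (hd.parent hp))
  moves u c c' hR _ hX hm hX' := by
    have h := hR.inA4
    have hl := h.legal_of_powerParent hX.1
    have hi := hX.1.idle
    have hi' := hX'.1.idle
    have hu := hX.1.ne_root
    have hdet : ¬ c.Detached u := fun hd => hl.P_ne_none hu (hd.2.1.resolve_right hu)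
    have hend : ¬ (c.EndFirstPhase u ∨ c.EndPhase u) := by
      rintro (h' | h') <;> simp [h'.1] at hi
    rcases hm with ⟨-, hl', -⟩ | ⟨-, hd, -⟩ | ⟨hr, -⟩ | ⟨hr, -⟩ |
      ⟨x, -, hd, -⟩ | ⟨q, -, -, -, -, -, hs⟩ | ⟨q, -, -, -, -, -, hs⟩ |
      ⟨-, -, -, he, -⟩ | ⟨-, -, -, he, -⟩
    · exact hl' hl
    · exact hdet hd
    · exact hu hr
    · exact hu hr
    · exact hdet hd
    · simp [hs.1] at hi'
    · simp [hs.1] at hi'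
    · exact hend he.2
    · exact hend he.2

theorem Calm.step (hR : c.RootFree c') (hQ : Calm c) : Calm c' :=
  fun u hpp => hQ u (hR.powerParent_back hpp)

theorem Calm.power_back (hR : c.RootFree c') (hQ : Calm c) (h : c'.S u = .power) :
    c.S u = .power :=
  (hR.power_back h).resolve_right (hQ u)

/-- A vertex outside the wave that conflicts with it is cut off from its parent. -/
theorem advances_attached : Advances (G := G) (r := r) Calm Attached where
  stable c c' hR hQ := hQ.step hR
  back u c c' hR hQ hX := by
    obtain ⟨hC, hP, v, hadj, hv⟩ := hX
    obtain ⟨p, hp⟩ := Option.ne_none_iff_exists'.1 hP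
    exact ⟨hR.color_back hC, by simp [hR.parent_back hp (.inl hC)], v, hadj, hQ.power_back hR hv⟩
  enabled u c h _ hX := by
    obtain ⟨hC, hP, v, hadj, hv⟩ := hX
    have hu : u ≠ r := by rintro rfl; exact hC rfl
    refine ⟨_, .RC5 u hu (h.not_strongConflict u) (.inl (.inl ⟨hu, hP, v, hadj, hv, ?_⟩))⟩
    rw [h.power_color hv]; exact hC.symm
  moves u c c' hR hQ hX hm hX' := by
    obtain ⟨hC, hP, v, hadj, hv⟩ := hX
    have hu : u ≠ r := by rintro rfl; exact hC rfl
    have hcon : c.Conflict u :=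
      .inl ⟨hu, hP, v, hadj, hv, by rw [hR.inA4.power_color hv]; exact hC.symm⟩
    rcases hm with ⟨-, -, -, hs⟩ | ⟨-, hd, -⟩ | ⟨hr, -⟩ | ⟨hr, -⟩ |
      ⟨x, -, hd, -⟩ | ⟨q, hp, hi, hw, hph, -, hs⟩ | ⟨q, hp, hi, hw, hph, -, hs⟩ |
      ⟨-, hok, -⟩ | ⟨-, hok, -⟩
    · exact hX'.2.1 hs.2.1
    · exact hP (hd.2.1.resolve_right hu)
    · exact hu hr
    · exact hu hr
    · exact hP (hd.2.1.resolve_right hu)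
    · exact hQ u (.base u q hp hi hw hph)
    · exact hQ u (.base u q hp hi hw hph)
    · exact hok.2.1 hcon
    · exact hok.2.1 hcon

/-- The children of the vertices that have been cut off are cut off. -/
theorem advances_belowJoining : Advances (G := G) (r := r)
    (fun c => Calm c ∧ ∀ u, ¬ c.Attached u) BelowJoining where
  stable := advances_attached.stable_and
  back w c c' hR hQ hX := by
    obtain ⟨u, hp, hC, v, hadj, hv⟩ := hX
    exact ⟨u, hR.parent_back hp (.inr hC), hR.color_back hC, v, hadj, hQ.1.power_back hR hv⟩
  enabled w c h hQ hX := by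
    obtain ⟨u, hp, hC, v, hadj, hv⟩ := hX
    have hu : u ≠ r := by rintro rfl; exact hC rfl
    have hP : c.P u = none := by
      by_contra hP
      exact hQ.2 u ⟨hC, hP, v, hadj, hv⟩
    have hE := (h.detached_or_weakE hu hP).resolve_left fun hd => child_ne_empty_of_P hp hd.1
    have hw := ne_root_of_P hp
    exact ⟨_, .RC5 w hw (h.not_strongConflict w)
      (.inr (.inr (.inr (.inr ⟨hw, u, hp, .inl hE⟩))))⟩
  moves w c c' hR hQ hX hm hX' := by
    obtain ⟨u, hp, hC, v, hadj, hv⟩ := hX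
    have hu : u ≠ r := by rintro rfl; exact hC rfl
    have hP : c.P u = none := by
      by_contra hP
      exact hQ.2 u ⟨hC, hP, v, hadj, hv⟩
    have hE := (hR.inA4.detached_or_weakE hu hP).resolve_left
      fun hd => child_ne_empty_of_P hp hd.1
    have hw := ne_root_of_P hp
    have hill : c.IllegalChild w := ⟨hw, u, hp, .inl hE⟩
    rcases hm with ⟨-, -, -, hs⟩ | ⟨-, hd, -⟩ | ⟨hr, -⟩ | ⟨hr, -⟩ |
      ⟨x, -, hd, -⟩ | ⟨q, hp, hi, hw, hph, -, hs⟩ | ⟨q, hp, hi, hw, hph, -, hs⟩ |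
      ⟨-, hok, -⟩ | ⟨-, hok, -⟩
    · obtain ⟨u', hp', -⟩ := hX'
      simp [hs.2.1] at hp'
    · simp [hd.2.1.resolve_right hw] at hp
    · exact hw hr
    · exact hw hr
    · simp [hd.2.1.resolve_right hw] at hp
    · exact hQ.1 w (.base w q hp hi hw hph)
    · exact hQ.1 w (.base w q hp hi hw hph)
    · exact hok.2.2.2.2.2 hill
    · exact hok.2.2.2.2.2 hill

/-- The detached neighbors of the `Power` vertices join the wave. -/
theorem advances_joining : Advances (G := G) (r := r)
    (fun c => (Calm c ∧ ∀ u, ¬ c.Attached u) ∧ ∀ w, ¬ c.BelowJoining w) Joining where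
  stable := advances_belowJoining.stable_and
  back u c c' hR hQ hX := by
    obtain ⟨hC, v, hadj, hv⟩ := hX
    exact ⟨hR.color_back hC, v, hadj, hQ.1.1.power_back hR hv⟩
  enabled u c h hQ hX := by
    obtain ⟨hC, v, hadj, hv⟩ := hX
    have hu : u ≠ r := by rintro rfl; exact hC rfl
    have hP : c.P u = none := by
      by_contra hP
      exact hQ.1.2 u ⟨hC, hP, v, hadj, hv⟩
    have hch : c.Child u = ∅ := Set.eq_empty_iff_forall_notMem.2 fun w hw =>
      hQ.2 w ⟨u, mem_child_iff.1 hw, hC, v, hadj, hv⟩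
    have hS : c.S u ≠ .power := fun hS => hC (h.power_color hS)
    have hd : c.Detached u := ⟨hch, .inl hP, hS⟩
    have hok : c.Ok u := by
      refine ⟨h.not_strongConflict u, ?_, h.not_powerFaulty u, h.not_faulty u,
        fun hi => hi.2.2 hd, ?_⟩
      · rintro (hc | hc)
        · exact hc.2.1 hP
        · exact hu hc.1
      · rintro ⟨-, p, hp, -⟩
        simp [hP] at hp
    refine ⟨_, .R3 u v hu hok ⟨hd, ?_, hadj, by rw [h.power_color hv]; exact hC.symm, hv⟩⟩
    rcases hs : c.S u with _ | _ | _ | _ | _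
    · exact .inr rfl
    · exact .inl (.inr (.inl hs))
    · exact absurd hs hS
    · exact .inl (.inl hs)
    · exact absurd hs (h.not_strongE u)
  moves u c c' hR hQ hX hm hX' := by
    have h := hR.inA4
    obtain ⟨hC, v, hadj, hv⟩ := hX
    have hu : u ≠ r := by rintro rfl; exact hC rfl
    have hP : c.P u = none := by
      by_contra hP
      exact hQ.1.2 u ⟨hC, hP, v, hadj, hv⟩
    rcases hm with ⟨-, -, hP', -⟩ | ⟨-, -, -, hn, -⟩ | ⟨hr, -⟩ | ⟨hr, -⟩ |
      ⟨x, -, -, -, -, hx, hs⟩ | ⟨q, hp, -⟩ | ⟨q, hp, -⟩ |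
      ⟨-, -, hP', -⟩ | ⟨-, -, hP', -⟩
    · exact hP' hP
    · rcases hn v hadj with hn | hn
      · exact hC (by rw [← hn, h.power_color hv])
      · exact hn hv
    · exact hu hr
    · exact hu hr
    · exact hX'.1 (by rw [hs.2.2.1, h.power_color hx, hR.root.2.2.1])
    · simp [hP] at hp
    · simp [hP] at hp
    · exact hP' hP
    · exact hP' hP

/-- The stage in which all neighbors of the `Power` vertices have joined the wave. -/
def Joined (c : Config G r) : Prop := Calm c ∧ ∀ u, ¬ c.Joining u

theorem Joined.step (hR : c.RootFree c') (hQ : Joined c) : Joined c' := by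
  refine ⟨hQ.1.step hR, fun u hX => hQ.2 u ?_⟩
  obtain ⟨hC, v, hadj, hv⟩ := hX
  exact ⟨hR.color_back hC, v, hadj, hQ.1.power_back hR hv⟩

theorem Joined.end_of_quiet (h : c.InA4) (hQ : Joined c) (hl : c.InLegalTree u)
    (hi : c.S u ≠ .idle) (hch : ∀ w, c.P w = some u → c.S w = .idle) :
    c.EndFirstPhase u ∨ c.EndPhase u := by
  have hq : c.QuietSubTree u := fun w hw => by
    have hp := mem_child_iff.1 hw
    exact ⟨hch w hp, h.ph_eq_of_not_powerParent (h.legal_of_parent hp hl) (hch w hp) (hQ.1 w) hp⟩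
  rcases hs : c.S u with _ | _ | _ | _ | _
  · exact absurd hs hi
  · exact .inr ⟨hs, hq⟩
  · refine .inl ⟨hs, hq, fun v hv => ?_⟩
    by_contra hC
    exact hQ.2 v ⟨by rwa [← hl.color], u, hv.symm, hs⟩
  · exact absurd hs (h.not_weakE_of_legal hl)
  · exact absurd hs (h.not_strongE u)

/-- The end of the phase climbs by one level in each round. -/
theorem advances_idleFrom (m : ℕ) : Advances (G := G) (r := r)
    (fun c => Joined c ∧ IdleFrom (m + 1) c)
    (fun u c => c.AtDepth (m + 1) u ∧ c.S u ≠ .idle) where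
  stable c c' hR hQ := by
    refine ⟨hQ.1.step hR, fun u d hm hd => ?_⟩
    by_contra hi
    obtain ⟨h1, h2⟩ := hR.not_idle_back hQ.1.1 hd hi
    exact h2 (hQ.2 u d hm h1)
  back u c c' hR hQ hX := hR.not_idle_back hQ.1.1 hX.1 hX.2
  enabled u c h hQ hX := by
    obtain ⟨hd, hi⟩ := hX
    have hl := hd.legal h
    have hu := hd.ne_root
    have he := hQ.1.end_of_quiet h hl hi fun w hp => hQ.2 w (m + 1) le_rfl (.child _ w u hp hd)
    by_cases hch : c.Child u = ∅
    · exact ⟨_, .R7 u hu (h.ok_of_legal hl) (hl.P_ne_none hu) ⟨hch, he⟩⟩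
    · exact ⟨_, .R6 u hu (h.ok_of_legal hl) ⟨hch, he⟩⟩
  moves u c c' hR hQ hX hm hX' := by
    obtain ⟨hd, hi⟩ := hX
    have hl := hd.legal hR.inA4
    have hu := hd.ne_root
    have hdet : ¬ c.Detached u := fun hd => hl.P_ne_none hu (hd.2.1.resolve_right hu)
    rcases hm with ⟨-, hl', -⟩ | ⟨-, hd, -⟩ | ⟨hr, -⟩ | ⟨hr, -⟩ |
      ⟨x, -, hd, -⟩ | ⟨q, -, hi', -⟩ | ⟨q, -, hi', -⟩ |
      ⟨-, -, -, -, hs⟩ | ⟨-, -, -, -, hs⟩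
    · exact hl' hl
    · exact hdet hd
    · exact hu hr
    · exact hu hr
    · exact hdet hd
    · exact hi hi'
    · exact hi hi'
    · exact hX'.2 hs.1
    · exact hX'.2 hs.1

/-- When the whole legal tree below the root is idle, the root is enabled. -/
theorem enabled_root (h : c.InA4) (hQ : Joined c) (hI : IdleFrom 0 c) : c.Enabled r := by
  have he := hQ.end_of_quiet h h.legal_root (by rcases h.root_S with hs | hs <;> simp [hs])
    fun w hp => hI w 0 le_rfl (.child _ w r hp .root)
  by_cases hch : c.Child r = ∅
  · exact ⟨_, .R1 (h.ok_of_legal h.legal_root) ⟨hch, he⟩ fun v _ => h.not_strongE v⟩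
  · exact ⟨_, .R2 (h.ok_of_legal h.legal_root) ⟨hch, he⟩⟩

/-! ### A potential for root-free steps -/

open Classical in
/-- The weight of a vertex bounds the number of its moves before the next move of the root. -/
noncomputable def weight (c : Config G r) (u : V) : ℕ :=
  (if c.C u ≠ c.C r then 3 else 0) +
    if c.P u = none then (if c.S u = .idle then 0 else 1)
    else if c.S u = .idle then (if c.PowerParent u then 4 else 2)
    else if c.S u = .working ∨ c.S u = .power then 3 else 2

theorem RootFree.weight_le (hR : c.RootFree c') (hs : c.Stays c' u) :
    c'.weight u ≤ c.weight u := by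
  have hpp := hR.powerParent_back (u := u)
  obtain ⟨h1, h2, h3, -⟩ := hs
  unfold weight
  rw [h1, h2, h3, hR.root.2.2.1]
  split_ifs <;> first | omega | tauto

theorem RootFree.weight_lt (hR : c.RootFree c') (hu : u ≠ r) (hm : c.Moves c' u) :
    c'.weight u < c.weight u := by
  have hpp := hR.powerParent_back (u := u)
  have hcr := hR.root.2.2.1
  have hend : c.EndFirstPhase u ∨ c.EndPhase u → c.S u = .working ∨ c.S u = .power := by
    rintro (he | he)
    · exact .inr he.1
    · exact .inl he.1
  have hidle : c.PowerParent u → c.S u = .idle := PowerParent.idle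
  unfold weight
  rcases hm with ⟨-, -, hP, hs⟩ | ⟨-, hd, hS, -, hs⟩ | ⟨hr, -⟩ | ⟨hr, -⟩ |
    ⟨x, -, hd, -, hC, hx, hs⟩ | ⟨q, hp, hi, hw, hph, -, hs⟩ | ⟨q, hp, hi, hw, hph, -, hs⟩ |
    ⟨-, -, hP, he, hs⟩ | ⟨-, -, hP, he, hs⟩
  · obtain ⟨h1, h2, h3, -⟩ := hs
    rw [h1, h2, h3, hcr]
    simp only [hP]
    split_ifs <;> simp_all
  · have hP := hd.2.1.resolve_right hu
    obtain ⟨h1, h2, h3, -⟩ := hs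
    rw [h1, h2, h3, hcr]
    have : c.S u ≠ .idle := by rcases hS with hS | hS <;> simp [hS]
    simp [hP, this]
  · exact absurd hr hu
  · exact absurd hr hu
  · have hP := hd.2.1.resolve_right hu
    obtain ⟨h1, h2, h3, -⟩ := hs
    have hxr := hR.inA4.power_color hx
    have hnp : ¬ c'.PowerParent u := fun h => by
      have := (hR.inA4.legal_of_powerParent (hpp h)).P_ne_none hu
      exact this hP
    rw [h1, h2, h3, hcr]
    rw [hxr] at hC ⊢
    simp [hnp, Ne.symm hC]
    omega
  · have hP : c.PowerParent u := .base u q hp hi hw hph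
    obtain ⟨h1, h2, h3, -⟩ := hs
    rw [h1, h2, h3, hcr]
    simp [hp, hi, hP]
  · have hP : c.PowerParent u := .base u q hp hi hw hph
    obtain ⟨h1, h2, h3, -⟩ := hs
    rw [h1, h2, h3, hcr]
    simp [hp, hi, hP]
  · have hS := hend he.2
    have hi : c.S u ≠ .idle := by rcases hS with hS | hS <;> simp [hS]
    have hnp : ¬ c'.PowerParent u := fun h => hi (hidle (hpp h))
    obtain ⟨h1, h2, h3, -⟩ := hs
    rw [h1, h2, h3, hcr]
    simp [hP, hi, hS, hnp]
  · have hS := hend he.2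
    have hi : c.S u ≠ .idle := by rcases hS with hS | hS <;> simp [hS]
    obtain ⟨h1, h2, h3, -⟩ := hs
    rw [h1, h2, h3, hcr]
    simp [hP, hi, hS]

/-! ### Counting the phases of a wave -/

/-- The number of vertices that the current wave has not reached. -/
noncomputable def unreached (c : Config G r) : ℕ := {u | c.C u ≠ c.C r}.ncard

/-- Each childless idle vertex below the root is influential: none of them has joined during
the current phase. -/
def NoNewLeaf (c : Config G r) : Prop :=
  ∀ u, c.InLegalTree u → u ≠ r → c.S u = .idle → c.Child u = ∅ → c.PowerParent u

theorem RootFree.noNewLeaf_or_lt [Finite V] (hR : c.RootFree c') (hN : c.NoNewLeaf) :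
    (c'.NoNewLeaf ∧ c'.unreached ≤ c.unreached) ∨ c'.unreached + 1 ≤ c.unreached := by
  have h := hR.inA4
  have hT := hR.trans
  have hsub : {u | c'.C u ≠ c'.C r} ⊆ {u | c.C u ≠ c.C r} := fun u hu => hR.color_back hu
  by_cases hj : ∃ u, c.C u ≠ c.C r ∧ c'.C u = c'.C r
  · obtain ⟨u, hu, hu'⟩ := hj
    exact .inr (Set.ncard_lt_ncard (hsub.ssubset_of_mem_notMem hu (by simp [hu'])))
  refine .inl ⟨fun u hl' hu hi' hch' => ?_, Set.ncard_le_ncard hsub⟩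
  have hl : c.InLegalTree u := by
    rcases h.legal_back hT hl' with hl | ⟨p, -, -, -, hC, hpow, hs⟩
    · exact hl
    · refine absurd ⟨u, ?_, ?_⟩ hj
      · rw [← h.power_color hpow]; exact hC.symm
      · rw [hs.2.2.1, h.power_color hpow, hR.root.2.2.1]
  -- A quiet child of `u` would still be there.
  have hkeep : ∀ w, c.P w = some u → c.S w = .idle → c.ph w = c.ph u → False := by
    intro w hp hi hph
    rcases h.stays_of_idle hT hp hi hph with hs | hs
    · exact child_ne_empty_of_P (c := c') (w := w) (by rw [hs.2.1, hp]) hch'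
    · exact hs.1 (h.legal_of_parent hp hl)
  have hdet : ¬ c.Detached u := fun hd => hl.P_ne_none hu (hd.2.1.resolve_right hu)
  rcases hT u with hs | ⟨-, hl', -⟩ | ⟨-, hd, -⟩ | ⟨hr, -⟩ | ⟨hr, -⟩ |
    ⟨x, -, hd, -⟩ | ⟨q, -, -, -, -, -, hs⟩ | ⟨q, -, -, -, -, -, hs⟩ |
    ⟨-, -, -, he, hs⟩ | ⟨-, -, -, he, hs⟩
  · have hi : c.S u = .idle := by rw [← hs.1, hi']
    refine h.powerParent_step hT (hN u hl hu hi ?_) hs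
    refine Set.eq_empty_iff_forall_notMem.2 fun w hw => ?_
    have hp := mem_child_iff.1 hw
    have hE := h.edge_of_idle hp hi
    exact hkeep w hp hE.1 hE.2
  · exact absurd hl hl'
  · exact absurd hd hdet
  · exact absurd hr hu
  · exact absurd hr hu
  · exact absurd hd hdet
  · simp [hs.1] at hi'
  · simp [hs.1] at hi'
  · obtain ⟨w, hw⟩ := Set.nonempty_iff_ne_empty.2 he.1
    have hq := quiet_of_end he.2 w hw
    exact (hkeep w (mem_child_iff.1 hw) hq.1 hq.2).elim
  · exact absurd hs.2.1 (hl'.P_ne_none hu)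

namespace InA4

variable (h : c.InA4)
include h

/-- A phase without a new leaf is the last one of its wave: as every old leaf becomes `Power` and
leaves the tree or gets a child, the tree could not end at the root only if it were infinite. -/
theorem not_noNewLeaf [Fintype V] (he : c.EndIntermediatePhase r) : ¬ c.NoNewLeaf := by
  intro hN
  have hq := quiet_of_end he.2
  have hall : ∀ d, ∃ u, c.AtDepth d u := by
    intro d
    induction d with
    | zero => exact ⟨r, .root⟩
    | succ d ih =>
      obtain ⟨u, hd⟩ := ih
      have hch : c.Child u ≠ ∅ := by
        by_cases hu : u = r
        · rw [hu]; exact he.1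
        · have hl := hd.legal h
          obtain ⟨hi, hpp, -⟩ := h.idle_of_quiet_root hq hl hu
          exact fun hch => hpp (hN u hl hu hi hch)
      obtain ⟨w, hw⟩ := Set.nonempty_iff_ne_empty.2 hch
      exact ⟨w, .child d w u (mem_child_iff.1 hw) hd⟩
  obtain ⟨u, hd⟩ := hall (Fintype.card V)
  exact lt_irrefl _ hd.lt_card

theorem unreached_add_two_le [Fintype V] (he : c.EndIntermediatePhase r) :
    c.unreached + 2 ≤ Fintype.card V := by
  obtain ⟨w, hw⟩ := Set.nonempty_iff_ne_empty.2 he.1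
  have hp := mem_child_iff.1 hw
  have hC := (h.legal_of_parent hp h.legal_root).color
  have hsub : ({r, w} : Set V) ⊆ {u | c.C u ≠ c.C r}ᶜ := by
    rintro u (rfl | rfl)
    · simp
    · simpa using hC
  have h1 := Set.ncard_le_ncard hsub
  rw [Set.ncard_pair (ne_root_of_P hp).symm] at h1
  have h2 := Set.ncard_add_ncard_compl {u | c.C u ≠ c.C r}
  rw [Nat.card_eq_fintype_card] at h2
  unfold unreached
  omega

theorem unreached_le_of_nextPhase [Finite V] (hT : ∀ u, c.Transition c' u)
    (hr : c'.C r = c.C r) : c'.unreached ≤ c.unreached := by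
  refine Set.ncard_le_ncard fun u hu hC => hu ?_
  by_cases hur : u = r
  · rw [hur]
  · rw [h.color_step hT hur hC, hr]

theorem noNewLeaf_of_nextPhase (hT : ∀ u, c.Transition c' u) (he : c.EndIntermediatePhase r)
    (hr : c'.Becomes r .working (c.P r) (c.C r) (!(c.ph r)) (c.TS r)) : c'.NoNewLeaf := by
  intro u hl' hu _ _
  have hq := quiet_of_end he.2
  rcases h.legal_back hT hl' with hl | ⟨p, -, -, hadj, hC, hpow, -⟩
  · exact h.powerParent_of_nextPhase hT hq hr.1 hr.2.2.2.1 hl hu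
  · exfalso
    by_cases hpr : p = r
    · subst hpr
      rcases he.2 with he | he
      · exact hC (he.2.2 u hadj.symm).symm
      · simp [he.1] at hpow
    · have := (h.idle_of_quiet_root hq (h.legal_of_power hpow) hpr).1
      simp [this] at hpow

end InA4

end Config

namespace Execution

open Config

variable {V : Type*} {G : SimpleGraph V} {r : V} (e : Execution G r)

/-! ### Executions from `A4` -/

section

variable (h0 : (e.cfg 0).InA4)
include h0

theorem inA4_and_transition (t : ℕ) :
    (e.cfg t).InA4 ∧ ∀ u, (e.cfg t).Transition (e.cfg (t + 1)) u := by
  have key : ∀ t, (e.cfg t).InA4 → ∀ u, (e.cfg t).Transition (e.cfg (t + 1)) u := by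
    intro t h u
    rcases e.step t with hs | ⟨-, -, hs⟩
    · exact h.transition_of_step hs u
    · exact .inl (by rw [hs]; exact ⟨rfl, rfl, rfl, rfl, rfl⟩)
  induction t with
  | zero => exact ⟨h0, key 0 h0⟩
  | succ t ih =>
    have h := ih.1.step ih.2
    exact ⟨h, key _ h⟩

theorem inA4 (t : ℕ) : (e.cfg t).InA4 := (e.inA4_and_transition h0 t).1

theorem transition (t : ℕ) (u : V) : (e.cfg t).Transition (e.cfg (t + 1)) u :=
  (e.inA4_and_transition h0 t).2 u

theorem moves {t : ℕ} {u : V} (hu : u ∈ e.act t) : (e.cfg t).Moves (e.cfg (t + 1)) u := by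
  rcases e.step t with hs | ⟨-, hs, -⟩
  · exact (e.inA4 h0 t).moves_of_move ((hs.2 u).1 hu)
  · simp [hs] at hu

omit h0 in
theorem stays {t : ℕ} {u : V} (hu : u ∉ e.act t) : (e.cfg t).Stays (e.cfg (t + 1)) u := by
  rcases e.step t with hs | ⟨-, -, hs⟩
  · exact becomes_of_st ((hs.2 u).2 hu)
  · rw [hs]; exact ⟨rfl, rfl, rfl, rfl, rfl⟩

theorem rootFree {t : ℕ} (hr : r ∉ e.act t) : (e.cfg t).RootFree (e.cfg (t + 1)) :=
  ⟨e.inA4 h0 t, e.transition h0 t, e.stays hr⟩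

theorem root_moves {t : ℕ} (hr : r ∈ e.act t) :
    ((e.cfg t).EndLastPhase r ∧ (e.cfg (t + 1)).Becomes r .power ((e.cfg t).P r)
      (!((e.cfg t).C r)) ((e.cfg t).ph r) ((e.cfg t).TS r)) ∨
    ((e.cfg t).EndIntermediatePhase r ∧ (e.cfg (t + 1)).Becomes r .working ((e.cfg t).P r)
      ((e.cfg t).C r) (!((e.cfg t).ph r)) ((e.cfg t).TS r)) := by
  rcases root_cases (.inr (e.moves h0 hr)) with hs | hs
  · rcases e.moves h0 hr with ⟨hr, -⟩ | ⟨hr, -⟩ | ⟨-, he, hs'⟩ | ⟨-, he, hs'⟩ | ⟨_, hr, -⟩ |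
      ⟨q, hp, -⟩ | ⟨q, hp, -⟩ | ⟨hr, -⟩ | ⟨hr, -⟩
    · exact absurd rfl hr
    · exact absurd rfl hr
    · exact .inl ⟨he, hs'⟩
    · exact .inr ⟨he, hs'⟩
    · exact absurd rfl hr
    · simp [P_root] at hp
    · simp [P_root] at hp
    · exact absurd rfl hr
    · exact absurd rfl hr
  · exact hs

/-! ### The number of rounds of a phase -/

/-- A stage is over after one round. -/
theorem round_of_advances {Q : Config G r → Prop} {X : V → Config G r → Prop} {i j : ℕ}
    (hA : Advances Q X) (hc : e.Covers i j) (hfree : ∀ t, i ≤ t → t < j → r ∉ e.act t)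
    (hQ : Q (e.cfg i)) : Q (e.cfg j) ∧ ∀ u, ¬ X u (e.cfg j) := by
  have hR : ∀ t, i ≤ t → t < j → (e.cfg t).RootFree (e.cfg (t + 1)) :=
    fun t h1 h2 => e.rootFree h0 (hfree t h1 h2)
  have hQt : ∀ t, i ≤ t → t ≤ j → Q (e.cfg t) := by
    intro t ht
    induction t, ht using Nat.le_induction with
    | base => exact fun _ => hQ
    | succ t ht ih => exact fun hj => hA.stable _ _ (hR t ht hj) (ih (by omega))
  refine ⟨hQt j hc.1 le_rfl, fun u hX => ?_⟩
  have hXt : ∀ s t, i ≤ t → t + s = j → X u (e.cfg t) := by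
    intro s
    induction s with
    | zero => rintro t - rfl; exact hX
    | succ s ih =>
      intro t ht hts
      exact hA.back u _ _ (hR t ht (by omega)) (hQt t ht (by omega))
        (ih (t + 1) (by omega) (by omega))
  have hXt' : ∀ t, i ≤ t → t ≤ j → X u (e.cfg t) := fun t h1 h2 =>
    hXt (j - t) t h1 (by omega)
  have hen : ∀ t, i ≤ t → t ≤ j → (e.cfg t).Enabled u := fun t h1 h2 =>
    hA.enabled u _ (e.inA4 h0 t) (hQt t h1 h2) (hXt' t h1 h2)
  obtain ⟨t, h1, h2, hact | hdis⟩ := hc.2 u (hen i le_rfl hc.1)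
  · exact hA.moves u _ _ (hR t h1 h2) (hQt t h1 h2.le) (hXt' t h1 h2.le) (e.moves h0 hact)
      (hXt' (t + 1) (by omega) h2)
  · exact hdis (hen (t + 1) (by omega) h2)

omit h0 in
theorem mono_of_covers {T : ℕ → ℕ} {M : ℕ} (hT : ∀ m < M, e.Covers (T m) (T (m + 1)))
    {a b : ℕ} (hab : a ≤ b) (hb : b ≤ M) : T a ≤ T b := by
  induction b, hab using Nat.le_induction with
  | base => rfl
  | succ b _ ih => exact (ih (by omega)).trans (hT b hb).1

/-- The root moves within `2 n + 2` rounds: `n - 1` rounds in which the influence descends, three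
in which the neighbors of the `Power` vertices join, `n - 1` in which the phase ends from the
leaves upwards, and one for the root itself. -/
theorem exists_root_move_of_covers [Fintype V] (T : ℕ → ℕ)
    (hT : ∀ m < 2 * Fintype.card V + 2, e.Covers (T m) (T (m + 1))) :
    ∃ t, T 0 ≤ t ∧ t < T (2 * Fintype.card V + 2) ∧ r ∈ e.act t := by
  by_contra! hno
  obtain ⟨N, hN⟩ : ∃ N, Fintype.card V = N + 1 :=
    Nat.exists_eq_add_one.2 (Fintype.card_pos_iff.2 ⟨r⟩)
  rw [hN] at hT hno
  have hround : ∀ {Q : Config G r → Prop} {X : V → Config G r → Prop} (m : ℕ),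
      m < 2 * (N + 1) + 2 → Advances Q X → Q (e.cfg (T m)) →
      Q (e.cfg (T (m + 1))) ∧ ∀ u, ¬ X u (e.cfg (T (m + 1))) := by
    intro Q X m hm hA hQ
    refine e.round_of_advances h0 hA (hT m hm) (fun t h1 h2 => hno t ?_ ?_) hQ
    · exact (e.mono_of_covers hT (Nat.zero_le m) hm.le).trans h1
    · exact h2.trans_le (e.mono_of_covers hT hm le_rfl)
  have hdown : ∀ m ≤ N, CalmTo m (e.cfg (T m)) := by
    intro m
    induction m with
    | zero =>
      intro _ u d hd hu hpp
      obtain rfl : d = 0 := by omega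
      exact hpp.ne_root hu.eq_root
    | succ m ih =>
      intro hm u d hd hu hpp
      obtain ⟨h1, h2⟩ := hround m (by omega) (advances_calmTo m) (ih (by omega))
      rcases hd.lt_or_eq with hd | rfl
      · exact h1 u d (by omega) hu hpp
      · exact h2 u ⟨hpp, hu⟩
  have hcalm : Calm (e.cfg (T N)) := by
    intro u hpp
    obtain ⟨d, hd⟩ := ((e.inA4 h0 _).legal_of_powerParent hpp).exists_atDepth
    have := hd.lt_card
    exact hdown N le_rfl u d (by omega) hd hpp
  have h1 := hround N (by omega) advances_attached hcalm
  have h2 := hround (N + 1) (by omega) advances_belowJoining h1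
  have h3 := hround (N + 2) (by omega) advances_joining h2
  have hup : ∀ m ≤ N, Joined (e.cfg (T (N + 3 + m))) ∧
      IdleFrom (N - m) (e.cfg (T (N + 3 + m))) := by
    intro m
    induction m with
    | zero =>
      refine fun _ => ⟨⟨h3.1.1.1, h3.2⟩, fun u d hd hu => ?_⟩
      have := hu.lt_card
      omega
    | succ m ih =>
      intro hm
      have ih := ih (by omega)
      rw [show N - m = N - (m + 1) + 1 by omega] at ih
      obtain ⟨h4, h5⟩ := hround (N + 3 + m) (by omega) (advances_idleFrom _) ih
      refine ⟨h4.1, fun u d hd hu => ?_⟩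
      rcases hd.lt_or_eq with hd | rfl
      · exact h4.2 u d (by omega) hu
      · by_contra hi
        exact h5 u ⟨hu, hi⟩
  have hlast := hup N le_rfl
  rw [Nat.sub_self] at hlast
  have hA : Advances (G := G) (r := r) (fun c => Joined c ∧ IdleFrom 0 c) (fun u _ => u = r) := by
    refine ⟨fun c c' hR hQ => ⟨hQ.1.step hR, fun u d hm hd => ?_⟩, fun u c c' hR hQ hu => hu,
      fun u c h hQ hu => hu ▸ enabled_root h hQ.1 hQ.2, ?_⟩
    · by_contra hi
      obtain ⟨h1, h2⟩ := hR.not_idle_back hQ.1.1 hd hi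
      exact h2 (hQ.2 u d hm h1)
    · rintro u c c' hR hQ rfl hm -
      have hS := hR.root.1
      have hC := hR.root.2.2.1
      have hph := hR.root.2.2.2.1
      rcases hm with ⟨hr, -⟩ | ⟨hr, -⟩ | ⟨-, -, hs⟩ | ⟨-, -, hs⟩ | ⟨_, hr, -⟩ |
        ⟨q, hp, -⟩ | ⟨q, hp, -⟩ | ⟨hr, -⟩ | ⟨hr, -⟩
      · exact hr rfl
      · exact hr rfl
      · simp [hs.2.2.1] at hC
      · simp [hs.2.2.2.1] at hph
      · exact hr rfl
      · simp [P_root] at hp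
      · simp [P_root] at hp
      · exact hr rfl
      · exact hr rfl
  exact (hround (N + 3 + N) (by omega) hA hlast).2 r rfl

/-- The root moves again and again, however unfair the daemon is. -/
theorem exists_root_move_ge [Fintype V] (t : ℕ) : ∃ t', t ≤ t' ∧ r ∈ e.act t' := by
  by_contra! hno
  have hdec : ∀ s, ∑ u, (e.cfg (t + s)).weight u + s ≤ ∑ u, (e.cfg t).weight u := by
    intro s
    induction s with
    | zero => simp
    | succ s ih =>
      have hr := hno (t + s) (by omega)
      have hR := e.rootFree h0 hr
      have hlt : ∑ u, (e.cfg (t + (s + 1))).weight u < ∑ u, (e.cfg (t + s)).weight u := by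
        rcases e.step (t + s) with hs | ⟨hs, -, -⟩
        · obtain ⟨u, hu⟩ := hs.1
          refine Finset.sum_lt_sum (fun v _ => ?_) ⟨u, Finset.mem_univ u, ?_⟩
          · by_cases hv : v ∈ e.act (t + s)
            · exact (hR.weight_lt (fun h => hr (h ▸ hv)) (e.moves h0 hv)).le
            · exact hR.weight_le (e.stays hv)
          · exact hR.weight_lt (fun h => hr (h ▸ hu)) (e.moves h0 hu)
        · -- In a terminal configuration all rounds are empty.
          obtain ⟨x, h1, h2, -⟩ := e.exists_root_move_of_covers h0 (fun _ => t + s)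
            fun _ _ => ⟨le_rfl, fun u hu => absurd hu (hs u)⟩
          omega
      omega
  have := hdec (∑ u, (e.cfg t).weight u + 1)
  omega

omit h0 in
theorem exists_covers_of_roundEnd {a b j : ℕ} (hj : e.RoundEnd (a + b) j) :
    ∃ T : ℕ → ℕ, e.RoundEnd a (T 0) ∧ T b = j ∧ ∀ m < b, e.Covers (T m) (T (m + 1)) := by
  induction b generalizing j with
  | zero => exact ⟨fun _ => j, hj, rfl, by simp⟩
  | succ b ih =>
    obtain ⟨i, hi, hij, -⟩ := hj
    obtain ⟨T, h1, rfl, h2⟩ := ih hi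
    refine ⟨fun m => if m ≤ b then T m else j, by simpa using h1, by simp, fun m hm => ?_⟩
    rcases (Nat.lt_succ_iff.1 hm).lt_or_eq with hm | rfl
    · simpa [hm.le, hm] using h2 m hm
    · simpa using hij

omit h0 in
theorem WithinRounds.mono {a b t : ℕ} (h : e.WithinRounds a t) (hab : a ≤ b) :
    e.WithinRounds b t := by
  intro j hj
  obtain ⟨b, rfl⟩ := Nat.exists_eq_add_of_le hab
  obtain ⟨T, h1, rfl, h2⟩ := e.exists_covers_of_roundEnd hj
  exact (h _ h1).trans (e.mono_of_covers h2 (Nat.zero_le b) le_rfl)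

theorem exists_next_root_move [Fintype V] {a t : ℕ} (ht : e.WithinRounds a t) :
    ∃ t', t ≤ t' ∧ r ∈ e.act t' ∧ (∀ s, t ≤ s → s < t' → r ∉ e.act s) ∧
      e.WithinRounds (a + (2 * Fintype.card V + 3)) (t' + 1) := by
  classical
  have hex := e.exists_root_move_ge h0 t
  refine ⟨Nat.find hex, (Nat.find_spec hex).1, (Nat.find_spec hex).2,
    fun s h1 h2 h3 => Nat.find_min hex h2 ⟨h1, h3⟩, fun j hj => ?_⟩
  obtain ⟨T, h1, rfl, h2⟩ := e.exists_covers_of_roundEnd hj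
  obtain ⟨s, h3, h4, h5⟩ := e.exists_root_move_of_covers h0 T fun m hm => h2 m (by omega)
  have h6 := Nat.find_min' hex ⟨(ht _ h1).trans h3, h5⟩
  have h7 := e.mono_of_covers h2 (Nat.le_succ (2 * Fintype.card V + 2)) le_rfl
  exact (Nat.succ_le_of_lt (h6.trans_lt h4)).trans h7

/-! ### The number of rounds of a wave -/

omit h0 in
/-- In step `t` the root starts a new wave. -/
def FlipsAt (t : ℕ) : Prop :=
  (e.cfg t).EndLastPhase r ∧ (e.cfg (t + 1)).Becomes r .power ((e.cfg t).P r)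
    (!((e.cfg t).C r)) ((e.cfg t).ph r) ((e.cfg t).TS r)

theorem exists_flip_of_noNewLeaf [Fintype V] (m : ℕ) {a t : ℕ} (ht : e.WithinRounds a t)
    (hN : (e.cfg t).NoNewLeaf) (hm : (e.cfg t).unreached ≤ m) :
    ∃ t', t ≤ t' ∧ e.FlipsAt t' ∧
      (∀ s, t ≤ s → s < t' → (e.cfg (s + 1)).C r = (e.cfg s).C r) ∧
      e.WithinRounds (a + (m + 1) * (2 * Fintype.card V + 3)) (t' + 1) := by
  induction m using Nat.strong_induction_on generalizing a t with
  | _ m ih =>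
  obtain ⟨t₁, h1, hact, hfree, hW⟩ := e.exists_next_root_move h0 ht
  have hcol : ∀ s, t ≤ s → s < t₁ → (e.cfg (s + 1)).C r = (e.cfg s).C r :=
    fun s h1 h2 => (e.stays (hfree s h1 h2)).2.2.1
  rcases e.root_moves h0 hact with hf | ⟨he, hs⟩
  · refine ⟨t₁, h1, hf, hcol, hW.mono e ?_⟩
    gcongr
    exact Nat.le_mul_of_pos_left _ (Nat.succ_pos m)
  -- As the wave goes on, a vertex has joined since `t`.
  have hinv : ∀ s, t ≤ s → s ≤ t₁ →
      ((e.cfg s).NoNewLeaf ∧ (e.cfg s).unreached ≤ m) ∨ (e.cfg s).unreached + 1 ≤ m := by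
    intro s hs
    induction s, hs using Nat.le_induction with
    | base => exact fun _ => .inl ⟨hN, hm⟩
    | succ s hs ih =>
      intro hs'
      have hR := e.rootFree h0 (hfree s hs hs')
      have hle : (e.cfg (s + 1)).unreached ≤ (e.cfg s).unreached :=
        hR.inA4.unreached_le_of_nextPhase hR.trans hR.root.2.2.1
      rcases ih (by omega) with ⟨h1, h2⟩ | h1
      · rcases hR.noNewLeaf_or_lt h1 with h3 | h3
        · exact .inl ⟨h3.1, by omega⟩
        · exact .inr (by omega)
      · exact .inr (by omega)
  have h := e.inA4 h0 t₁
  have hT := e.transition h0 t₁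
  have hlt := (hinv t₁ h1 le_rfl).resolve_left fun hn => h.not_noNewLeaf he hn.1
  have hle := h.unreached_le_of_nextPhase hT hs.2.2.1
  obtain ⟨m, rfl⟩ : ∃ m', m = m' + 1 := ⟨m - 1, by omega⟩
  obtain ⟨t₂, h2, hf, hcol', hW'⟩ := ih m (by omega) hW (h.noNewLeaf_of_nextPhase hT he hs)
    (by omega)
  refine ⟨t₂, by omega, hf, fun s h3 h4 => ?_, ?_⟩
  · rcases lt_trichotomy s t₁ with h5 | rfl | h5
    · exact hcol s h3 h5
    · exact hs.2.2.1
    · exact hcol' s h5 h4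
  · convert hW' using 1
    ring

/-- A wave has at most `n` phases: when its first phase ends with a new one, the root and a child
have been reached, and each later phase but the last adds a vertex to the part of the graph that
the wave has reached. -/
theorem exists_flip [Fintype V] {a t : ℕ} (ht : e.WithinRounds a t) :
    ∃ t', t ≤ t' ∧ e.FlipsAt t' ∧
      (∀ s, t ≤ s → s < t' → (e.cfg (s + 1)).C r = (e.cfg s).C r) ∧
      e.WithinRounds (a + Fintype.card V * (2 * Fintype.card V + 3)) (t' + 1) := by
  obtain ⟨t₁, h1, hact, hfree, hW⟩ := e.exists_next_root_move h0 ht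
  have hcol : ∀ s, t ≤ s → s < t₁ → (e.cfg (s + 1)).C r = (e.cfg s).C r :=
    fun s h1 h2 => (e.stays (hfree s h1 h2)).2.2.1
  rcases e.root_moves h0 hact with hf | ⟨he, hs⟩
  · refine ⟨t₁, h1, hf, hcol, hW.mono e ?_⟩
    gcongr
    exact Nat.le_mul_of_pos_left _ (Fintype.card_pos_iff.2 ⟨r⟩)
  have h := e.inA4 h0 t₁
  have hT := e.transition h0 t₁
  have hU := h.unreached_add_two_le he
  have hle := h.unreached_le_of_nextPhase hT hs.2.2.1
  obtain ⟨n, hn⟩ : ∃ n, Fintype.card V = n + 2 := ⟨Fintype.card V - 2, by omega⟩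
  obtain ⟨t₂, h2, hf, hcol', hW'⟩ := e.exists_flip_of_noNewLeaf h0 n hW
    (h.noNewLeaf_of_nextPhase hT he hs) (by omega)
  refine ⟨t₂, by omega, hf, fun s h3 h4 => ?_, ?_⟩
  · rcases lt_trichotomy s t₁ with h5 | rfl | h5
    · exact hcol s h3 h5
    · exact hs.2.2.1
    · exact hcol' s h5 h4
  · convert hW' using 1
    rw [hn]
    ring

theorem wave_of_color_eq (hG : G.Connected) {k l t t' : ℕ} (hW : (e.cfg t).Wave k l)
    (htt' : t ≤ t') (hcol : ∀ s, t ≤ s → s < t' → (e.cfg (s + 1)).C r = (e.cfg s).C r) :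
    ∃ k, (e.cfg t').Wave k l := by
  induction t', htt' using Nat.le_induction with
  | base => exact ⟨k, hW⟩
  | succ s hs ih =>
    obtain ⟨k, hW⟩ := ih fun s h1 h2 => hcol s h1 (by omega)
    have hT := e.transition h0 s
    rcases root_cases (hT r) with hr | ⟨-, hr⟩ | ⟨he, hr⟩
    · exact ⟨k, hW.step_of_stays hG hT hr⟩
    · have := hcol s hs (by omega)
      simp [hr.2.2.1] at this
    · exact hW.step_of_nextPhase hG hT he hr

theorem exists_wave [Fintype V] (hG : G.Connected) (l : ℕ) :
    ∃ t, (e.cfg t).Wave 1 l ∧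
      e.WithinRounds ((l + 1) * Fintype.card V * (2 * Fintype.card V + 3)) t := by
  induction l with
  | zero =>
    have hstart : e.WithinRounds 0 0 := fun j _ => Nat.zero_le j
    obtain ⟨t, -, hf, -, hW⟩ := e.exists_flip h0 hstart
    refine ⟨t + 1, (e.inA4 h0 t).wave_of_flip hG (e.transition h0 t) hf.2, ?_⟩
    convert hW using 1
    ring
  | succ l ih =>
    obtain ⟨t, hw, ht⟩ := ih
    obtain ⟨t', htt', hf, hcol, hW⟩ := e.exists_flip h0 ht
    obtain ⟨k, hw'⟩ := e.wave_of_color_eq h0 hG hw htt' hcol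
    refine ⟨t' + 1, hw'.step_of_flip hG (e.transition h0 t') hf.1 hf.2, ?_⟩
    convert hW using 1
    ring

end

end Execution

end BFSTree

theorem mainTheorem2 {V : Type*} [Fintype V] (G : SimpleGraph V) (hG : G.Connected) (r : V)
    (e : BFSTree.Execution G r) (h : (e.cfg 0).InA4) :
    ∃ i, (e.cfg i).InAl ∧
      e.WithinRounds
        ((G.diam + 2) * Fintype.card V * (2 * Fintype.card V + 3)) i := by
  obtain ⟨t, hw, ht⟩ := e.exists_wave h hG (G.diam + 1)
  exact ⟨t, ⟨1, le_rfl, by omega, hw.inA4Layer hG (by omega)⟩, ht⟩
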